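/- **Theorem (quenched CLT for a typical configuration).** For each $n$ let $G_n=(V_n,E_n)$ be a finite simple graph and let $\mathcal S=\mathcal S_n$ be a finite family of spanning subgraphs of $G_n$, identified with their edge sets. Write $\mathbb P_\pi$ for the law of $\pi$ chosen uniformly at random from $\mathcal S_n$; a *partial matching* is a set $\Gamma\subseteq E_n$ of pairwise vertex-disjoint edges. Assume that for all sufficiently large $n$ (the constants $c,\rho,\rho'$ and those in $\Theta$ not depending on $n$): (I) $G_n$ is edge-transitive, $|V_n|=c\,n$ for some $c\in\mathbb N$, and $|E_n|=\Theta(|V_n|^2)$. (II) The weights $\{\omega_e\}_{e\in E_n}$ are i.i.d. with a law on $(-\infty,\infty]$ which does not depend on $n$ and is such that $\psi(\beta):=\log\mathbb E\,e^{-\beta\omega}$ is a (finite) real number for all $\beta\in(0,\infty)$, where $e^{-\infty}=0$; the weights may equal $+\infty$ with positive probability. (III) 1. All $\pi\in\mathcal S_n$ have the same number $m=m_n$ of edges, $\lim_{n\to\infty} m^2/(2|E_n|)=\gamma\in(0,\infty)$, and every edge is equally likely to be used: $\mathbb P_\pi(e\in\pi)=m/|E_n|$ for every $e\in E_n$. 2.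 For every partial matching $\Gamma$ there is $\pi\in\mathcal S_n$ with $\Gamma\subseteq\pi$. 3. There is $\rho\in(0,\infty)$ such that $\left|\dfrac{\mathbb P_\pi(\Gamma\subseteq\pi)}{\prod_{e\in\Gamma}\mathbb P_\pi(e\in\pi)}-1\right|\le \dfrac{\rho^{|\Gamma|}}{\sqrt m}$ for every partial matching $\Gamma$. 4. There is $\rho'\in(0,\infty)$ such that $\mathbb P_\pi(\Gamma\subseteq\pi)\le \rho'^{|\Gamma|}\prod_{e\in\Gamma}\mathbb P_\pi(e\in\pi)$ for every $\Gamma\subseteq E_n$ that is contained in some element of $\mathcal S_n$ and is not a partial matching. For $\beta\in(0,\infty)$ let $W(\pi)=\sum_{e\in\pi}\omega_e$, and let $\mathbb P_{\beta,\omega}(\pi)=\dfrac{e^{-\beta W(\pi)}}{\sum_{\pi'\in\mathcal S_n}e^{-\beta W(\pi')}}$, $\pi\in\mathcal S_n$, be the Gibbs measure (with an arbitrary convention, such as the zero measure, on the event that the denominator vanishes). Fix $\beta\in(0,\infty)$. Then $\psi$ is twice continuously differentiable near $\beta$, $\psi''(\beta)\ge0$, and for $\pi\sim\mathbb P_{\beta,\omega}$,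 as $n\to\infty$, $$\frac{W(\pi)+m\,\psi'(\beta)}{\sqrt m}\ \Rightarrow\ N\bigl(0,\psi''(\beta)\bigr)$$ in the quenched sense: the law of the left-hand side under $\mathbb P_{\beta,\omega}$, given the weights $\omega$, converges weakly to $N(0,\psi''(\beta))$ in probability with respect to $\omega$. That is, for every bounded continuous $f:\mathbb R\to\mathbb R$, $$\sum_{\pi\in\mathcal S_n}\mathbb P_{\beta,\omega}(\pi)\,f\!\left(\frac{W(\pi)+m\psi'(\beta)}{\sqrt m}\right)\longrightarrow \int f\,dN(0,\psi''(\beta))\quad\text{in probability},$$ where $N(0,0)$ is the point mass at $0$. -/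

import Mathlib

open MeasureTheory ProbabilityTheory Filter Topology Asymptotics
open scoped ENNReal BoundedContinuousFunction

namespace RandomOpt

noncomputable section

/-! ### Graphs and families of configurations

A spanning subgraph of `G` is identified with its set of edges, a `Finset G.edgeSet`, and a family
of configurations is a `Finset (Finset G.edgeSet)`. -/

/-- The automorphism group of `G` acts transitively on the edges. -/
def IsEdgeTransitive {V : Type*} (G : SimpleGraph V) : Prop :=
  ∀ e ∈ G.edgeSet, ∀ f ∈ G.edgeSet, ∃ φ : G ≃g G, Sym2.map φ e = f

/-- A partial matching: a set of pairwise vertex-disjoint edges. -/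
def IsPartialMatching {V : Type*} {G : SimpleGraph V} (Γ : Finset G.edgeSet) : Prop :=
  ∀ e ∈ Γ, ∀ f ∈ Γ, e ≠ f → ∀ v : V, v ∈ (e : Sym2 V) → v ∉ (f : Sym2 V)

open Classical in
/-- `P_π(Γ ⊆ π)` for `π` chosen uniformly at random from `S`. -/
def inclProb {E : Type*} (S : Finset (Finset E)) (Γ : Finset E) : ℝ :=
  ((S.filter fun π => Γ ⊆ π).card : ℝ) / (S.card : ℝ)

/-- Assumption on the sequence of graphs: (for all large `n`) `G n` is edge-transitive with `c * n`
vertices, and the number of edges is of the order of the square of the number of vertices. -/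
structure GraphAssumption {V : ℕ → Type*} (G : ∀ n, SimpleGraph (V n)) : Prop where
  edgeTransitive : ∀ᶠ n in atTop, IsEdgeTransitive (G n)
  card_vertices : ∃ c : ℕ, ∀ᶠ n in atTop, Nat.card (V n) = c * n
  card_edges : (fun n => (Nat.card (G n).edgeSet : ℝ)) =Θ[atTop]
    (fun n => (Nat.card (V n) : ℝ) ^ 2)

/-- Assumption on the families `S n` of configurations, all of size `m n`. -/
structure FamilyAssumption {V : ℕ → Type*} (G : ∀ n, SimpleGraph (V n))
    (S : ∀ n, Finset (Finset (G n).edgeSet)) (m : ℕ → ℕ) : Prop where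
  /-- All configurations have the same number `m` of edges. -/
  card_eq : ∀ᶠ n in atTop, ∀ π ∈ S n, π.card = m n
  /-- `m² / (2|E|)` converges to a positive real. -/
  gamma : ∃ γ : ℝ, 0 < γ ∧
    Tendsto (fun n => (m n : ℝ) ^ 2 / (2 * (Nat.card (G n).edgeSet : ℝ))) atTop (𝓝 γ)
  /-- Every edge is contained in a uniform configuration with the same probability `m / |E|`. -/
  edge_prob : ∀ᶠ n in atTop, ∀ e : (G n).edgeSet,
    inclProb (S n) {e} = (m n : ℝ) / (Nat.card (G n).edgeSet : ℝ)
  /-- Every partial matching is contained in some configuration. -/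
  extend : ∀ᶠ n in atTop, ∀ Γ : Finset (G n).edgeSet, IsPartialMatching Γ → ∃ π ∈ S n, Γ ⊆ π
  /-- Inclusion probabilities of partial matchings almost factorize. -/
  matching : ∃ ρ : ℝ, 0 < ρ ∧ ∀ᶠ n in atTop, ∀ Γ : Finset (G n).edgeSet, IsPartialMatching Γ →
    |inclProb (S n) Γ / ∏ e ∈ Γ, inclProb (S n) {e} - 1| ≤ ρ ^ Γ.card / √(m n : ℝ)
  /-- Bound for the subsets of configurations that are not partial matchings. -/
  nonmatching : ∃ ρ : ℝ, 0 < ρ ∧ ∀ᶠ n in atTop, ∀ Γ : Finset (G n).edgeSet,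
    (∃ π ∈ S n, Γ ⊆ π) → ¬ IsPartialMatching Γ →
    inclProb (S n) Γ ≤ ρ ^ Γ.card * ∏ e ∈ Γ, inclProb (S n) {e}

/-! ### Weights

Weights may be `+∞` with positive probability, hence they are `EReal`-valued. -/

/-- `exp (-β x)` for an extended real `x`; for `β > 0` it is `0` at `x = +∞` and `+∞` at `-∞`. -/
def boltzmann (β : ℝ) (x : EReal) : ℝ≥0∞ := EReal.exp (-((β : EReal) * x))

/-- `E[exp (-β ω)]` for a weight `ω` with law `ν`. -/
def laplace (ν : Measure EReal) (β : ℝ) : ℝ≥0∞ := ∫⁻ x, boltzmann β x ∂ν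

/-- `ψ(β) = log E[exp (-β ω)]`, for a weight `ω` with law `ν`. -/
def psi (ν : Measure EReal) (β : ℝ) : ℝ := Real.log (laplace ν β).toReal

/-- Assumption on the law of the weights: `ψ(β)` is a (finite) real number for every `β > 0`.
Finiteness of `laplace` forces `ω > -∞` a.s., positivity says that `ω` is not a.s. `+∞`. -/
def WeightAssumption (ν : Measure EReal) : Prop :=
  ∀ β : ℝ, 0 < β → 0 < laplace ν β ∧ laplace ν β < ∞

/-! ### The Gibbs measure -/

/-- The weight `W(π) = ∑_{e ∈ π} w e` of a configuration. -/
def weight {E : Type*} (w : E → EReal) (π : Finset E) : EReal := ∑ e ∈ π, w e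

/-- The partition function `Z(β, w) = |S|⁻¹ ∑_{π ∈ S} exp (-β W(π))`. -/
def partitionFn {E : Type*} (S : Finset (Finset E)) (β : ℝ) (w : E → EReal) : ℝ≥0∞ :=
  (∑ π ∈ S, boltzmann β (weight w π)) / (S.card : ℝ≥0∞)

/-- The Gibbs probability `exp (-β W(π)) / (Z(β, w) |S|)` of `π ∈ S`.
It is a probability on `S` when `0 < Z < ∞`, and is set to `0` for all `π` when `Z = 0` (all
configurations have weight `+∞`). -/
def gibbsProb {E : Type*} (S : Finset (Finset E)) (β : ℝ) (w : E → EReal) (π : Finset E) : ℝ :=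
  (boltzmann β (weight w π) / (partitionFn S β w * (S.card : ℝ≥0∞))).toReal

/-- The Gibbs average of `g`, that is, its expectation under the Gibbs measure with the weights
`w` frozen. -/
def gibbsAverage {E : Type*} (S : Finset (Finset E)) (β : ℝ) (w : E → EReal)
    (g : Finset E → ℝ) : ℝ :=
  ∑ π ∈ S, gibbsProb S β w π * g π

end

end RandomOpt

namespace RandomOpt

noncomputable section

/-! ### The law of a single weight -/

/-! Put `a = e^{-βω} / E e^{-βω}`, which has mean one, and `u = ω + ψ'(β)`. All configurations have
`m` edges, so the Gibbs average of `f` is a ratio `T_f / Z`, where `Z` is the uniform average over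
`π` of `∏ a` and `T_f` the same average with the extra factor `f(∑ u / √m)`. For `f(y) = e^{ity}`
the numerator is again an average of products, now of `a e^{itu/√m}`. Let `κ` be the mean of this
function and `g = κ⁻¹ a e^{itu/√m}`. The numerator is `κ^m` times the average of `∏ g`, and `κ^m`
tends to the Gaussian characteristic function by the classical CLT for one edge under the
exponentially tilted law. It remains to see that the averages of `∏ g` and `∏ a` agree
asymptotically.

The average of `∏ g` is a polynomial in the independent centred variables `g(ω_e) - 1`, with the
inclusion probabilities of edge sets as coefficients (`avgProd_eq_sum`), and its monomials are
orthogonal. The assumptions on the family make these coefficients close to `p^|Γ|`, `p = m/|E|`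
(`tendsto_sum_sq_inclProb_sub`), so the average is `L²`-close to `∏_e (1 + p (g - 1))`. Since
`p²|E|` stays bounded and `g → a` in `L²`, replacing `g` by `a` in this product costs nothing in the
limit (`IsAlmostIndependent.tendsto_prod_sub_prod`). The same product has a bounded inverse moment
when built from `a`, so `Z` is rarely small (`IsAlmostIndependent.exists_measure_partitionAvg_lt`).

To pass from exponentials to `f`, the numerators are integrated over arbitrary events `A_n`. Lévy's
theorem for the resulting annealed laws gives `∫_{A_n} (T_f - Z ∫ f dN) → 0`. With `A_n` the event
that the ratio deviates while `Z ≥ η`, this forces `P(A_n) → 0`. -/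

lemma boltzmann_coe (β x : ℝ) : boltzmann β (x : EReal) = ENNReal.ofReal (Real.exp (β * -x)) := by
  rw [boltzmann, ← EReal.coe_mul, ← EReal.coe_neg, EReal.exp_coe, mul_neg]

lemma boltzmann_top {β : ℝ} (hβ : 0 < β) : boltzmann β ⊤ = 0 := by
  simp [boltzmann, EReal.coe_mul_top_of_pos hβ]

lemma boltzmann_bot {β : ℝ} (hβ : 0 < β) : boltzmann β ⊥ = ∞ := by
  simp [boltzmann, EReal.coe_mul_bot_of_pos hβ]

lemma measurable_boltzmann (β : ℝ) : Measurable (boltzmann β) := by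
  unfold boltzmann
  have h : Measurable EReal.exp := EReal.exp_monotone.measurable
  refine h.comp (Measurable.neg ?_)
  fun_prop

lemma measure_bot_eq_zero {ν : Measure EReal} (hν : WeightAssumption ν) : ν {⊥} = 0 := by
  have h := ae_lt_top (measurable_boltzmann 1) (hν 1 one_pos).2.ne
  refine measure_mono_null ?_ (ae_iff.1 h)
  rintro x rfl
  simp [boltzmann_bot]

lemma ae_ne_bot {ν : Measure EReal} (hν : WeightAssumption ν) : ∀ᵐ x ∂ν, x ≠ ⊥ := by
  rw [ae_iff]
  simpa using measure_bot_eq_zero hν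

/-- The law of `-ω` on the event that the weight `ω` is finite. -/
def negLaw (ν : Measure EReal) : Measure ℝ := (ν.restrict {⊤}ᶜ).map fun x => -x.toReal

instance (ν : Measure EReal) [IsFiniteMeasure ν] : IsFiniteMeasure (negLaw ν) := by
  unfold negLaw; infer_instance

/-- Infinite weights contribute nothing for `β > 0`, so the possibly defective law `negLaw ν`
carries all of the Laplace transform, and the theory of `mgf` and `cgf` on `ℝ` becomes available. -/
lemma laplace_eq_lintegral_negLaw {ν : Measure EReal} (hν : WeightAssumption ν) {β : ℝ}
    (hβ : 0 < β) : laplace ν β = ∫⁻ y, ENNReal.ofReal (Real.exp (β * y)) ∂(negLaw ν) := by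
  rw [negLaw, lintegral_map (by fun_prop) (by fun_prop), laplace,
    ← lintegral_indicator (by measurability)]
  refine lintegral_congr_ae ?_
  filter_upwards [ae_ne_bot hν] with x hx
  induction x with
  | bot => simp at hx
  | top => simp [boltzmann_top hβ]
  | coe x => simp [boltzmann_coe]

lemma integrable_exp_negLaw {ν : Measure EReal} (hν : WeightAssumption ν) {β : ℝ} (hβ : 0 < β) :
    Integrable (fun y => Real.exp (β * y)) (negLaw ν) := by
  refine ⟨by fun_prop, ?_⟩
  rw [hasFiniteIntegral_iff_ofReal (by filter_upwards with x using by positivity),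
    ← laplace_eq_lintegral_negLaw hν hβ]
  exact (hν β hβ).2

lemma mem_interior_integrableExpSet {ν : Measure EReal} (hν : WeightAssumption ν) {β : ℝ}
    (hβ : 0 < β) : β ∈ interior (integrableExpSet id (negLaw ν)) := by
  rw [mem_interior]
  exact ⟨Set.Ioi 0, fun x hx => integrable_exp_negLaw hν hx, isOpen_Ioi, hβ⟩

lemma toReal_laplace {ν : Measure EReal} (hν : WeightAssumption ν) {β : ℝ} (hβ : 0 < β) :
    (laplace ν β).toReal = mgf id (negLaw ν) β := by
  rw [laplace_eq_lintegral_negLaw hν hβ, mgf, integral_eq_lintegral_of_nonneg_ae]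
  · rfl
  · filter_upwards with x using by positivity
  · fun_prop

/-- Only a local identity, which suffices for derivatives: for `β ≤ 0` it can fail, because weights
`+∞` then contribute to `laplace`. -/
lemma psi_eventuallyEq {ν : Measure EReal} (hν : WeightAssumption ν) {β : ℝ} (hβ : 0 < β) :
    psi ν =ᶠ[𝓝 β] cgf id (negLaw ν) := by
  filter_upwards [lt_mem_nhds hβ] with x hx
  rw [psi, toReal_laplace hν hx, cgf]

lemma contDiffAt_psi {ν : Measure EReal} (hν : WeightAssumption ν) {β : ℝ} (hβ : 0 < β) :
    ContDiffAt ℝ 2 (psi ν) β :=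
  ((analyticAt_cgf (mem_interior_integrableExpSet hν hβ)).contDiffAt).congr_of_eventuallyEq
    (psi_eventuallyEq hν hβ)

/-- The law of `-ω` under the exponentially tilted law of the weight. -/
def tiltedLaw (ν : Measure EReal) (β : ℝ) : Measure ℝ := (negLaw ν).tilted (β * ·)

lemma negLaw_ne_zero {ν : Measure EReal} (hν : WeightAssumption ν) : negLaw ν ≠ 0 := by
  intro h
  have := (hν 1 one_pos).1
  rw [laplace_eq_lintegral_negLaw hν one_pos, h] at this
  simp at this

lemma isProbabilityMeasure_tiltedLaw {ν : Measure EReal} (hν : WeightAssumption ν) {β : ℝ}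
    (hβ : 0 < β) : IsProbabilityMeasure (tiltedLaw ν β) := by
  have : NeZero (negLaw ν) := ⟨negLaw_ne_zero hν⟩
  exact isProbabilityMeasure_tilted (integrable_exp_negLaw hν hβ)

/-- Derivatives of a cumulant generating function are cumulants of the tilted law. Since this is a
law of `-ω`, the weight itself has tilted mean `-ψ'(β)`, whence the sign of the centring. -/
lemma integral_tiltedLaw {ν : Measure EReal} (hν : WeightAssumption ν) {β : ℝ} (hβ : 0 < β) :
    ∫ y, y ∂(tiltedLaw ν β) = deriv (psi ν) β := by
  rw [(psi_eventuallyEq hν hβ).deriv_eq,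
    ← integral_tilted_mul_self (mem_interior_integrableExpSet hν hβ)]
  rfl

lemma variance_tiltedLaw {ν : Measure EReal} (hν : WeightAssumption ν) {β : ℝ} (hβ : 0 < β) :
    Var[id; tiltedLaw ν β] = deriv (deriv (psi ν)) β := by
  rw [(psi_eventuallyEq hν hβ).deriv.deriv_eq, tiltedLaw]
  have := variance_tilted_mul (mem_interior_integrableExpSet hν hβ)
  rw [iteratedDeriv_succ, iteratedDeriv_one] at this
  exact this

lemma memLp_tiltedLaw {ν : Measure EReal} (hν : WeightAssumption ν) {β : ℝ} (hβ : 0 < β) :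
    MemLp id 2 (tiltedLaw ν β) :=
  memLp_tilted_mul (mem_interior_integrableExpSet hν hβ) 2

/-- The Boltzmann factor normalised to have mean `1`. -/
def normWeight (ν : Measure EReal) (β : ℝ) (x : EReal) : ℝ :=
  (boltzmann β x).toReal / (laplace ν β).toReal

lemma normWeight_nonneg (ν : Measure EReal) (β : ℝ) (x : EReal) : 0 ≤ normWeight ν β x := by
  unfold normWeight; positivity

lemma measurable_normWeight (ν : Measure EReal) (β : ℝ) : Measurable (normWeight ν β) :=
  ((measurable_boltzmann β).ennreal_toReal).div_const _

/-- The density `normWeight` vanishes at `⊤`, so the default value of `toReal` there is harmless. -/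
lemma integral_normWeight_smul {ν : Measure EReal} (hν : WeightAssumption ν) {β : ℝ} (hβ : 0 < β)
    {g : ℝ → ℂ} (hg : Measurable g) :
    ∫ x, normWeight ν β x • g (-x.toReal) ∂ν = ∫ y, g y ∂(tiltedLaw ν β) := by
  rw [tiltedLaw]
  have := integral_tilted_mul_eq_mgf (μ := negLaw ν) (X := id) (t := β) g
  simp only [id] at this
  rw [this, ← toReal_laplace hν hβ, negLaw, integral_map (by fun_prop) (by fun_prop),
    ← integral_indicator (by measurability)]
  refine integral_congr_ae ?_
  filter_upwards [ae_ne_bot hν] with x hx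
  induction x with
  | bot => simp at hx
  | top => simp [boltzmann_top hβ, normWeight]
  | coe x =>
    have : (x : EReal) ∈ ({⊤}ᶜ : Set EReal) := by simp
    rw [Set.indicator_of_mem this, normWeight, boltzmann_coe, ENNReal.toReal_ofReal (by positivity)]
    simp

lemma integral_normWeight {ν : Measure EReal} (hν : WeightAssumption ν) {β : ℝ} (hβ : 0 < β) :
    ∫ x, normWeight ν β x ∂ν = 1 := by
  have := isProbabilityMeasure_tiltedLaw hν hβ
  have := integral_normWeight_smul hν hβ (g := fun _ => 1) (by fun_prop)
  simp only [integral_const, probReal_univ, Complex.real_smul, mul_one, Complex.ofReal_one,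
    integral_complex_ofReal] at this
  exact_mod_cast this

/-- The square of the Boltzmann factor at `β` is the one at `2β`, so finiteness of `laplace` at `2β`
gives the second moment. -/
lemma memLp_normWeight {ν : Measure EReal} (hν : WeightAssumption ν) {β : ℝ} (hβ : 0 < β) :
    MemLp (normWeight ν β) 2 ν := by
  rw [memLp_two_iff_integrable_sq (measurable_normWeight ν β).aestronglyMeasurable]
  have h : Integrable (fun x => (boltzmann (2 * β) x).toReal) ν :=
    integrable_toReal_of_lintegral_ne_top (measurable_boltzmann _).aemeasurable
      (hν (2 * β) (by positivity)).2.ne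
  refine (h.div_const ((laplace ν β).toReal ^ 2)).congr ?_
  filter_upwards [ae_ne_bot hν] with x hx
  induction x with
  | bot => simp at hx
  | top => simp [boltzmann_top hβ, boltzmann_top (show 0 < 2 * β by positivity), normWeight]
  | coe x =>
    simp only [normWeight, div_pow, boltzmann_coe]
    rw [ENNReal.toReal_ofReal (by positivity), ENNReal.toReal_ofReal (by positivity),
      ← Real.exp_nat_mul]
    congr 2
    push_cast
    ring

/-- Convergence of characteristic functions in the central limit theorem. -/
lemma tendsto_charFun_sub_mean_pow {μ : Measure ℝ} [IsProbabilityMeasure μ] (hμ : MemLp id 2 μ)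
    (t : ℝ) :
    Tendsto (fun n : ℕ => charFun (μ.map fun x => x - ∫ y, y ∂μ) ((√n)⁻¹ * t) ^ n) atTop
      (𝓝 (charFun (gaussianReal 0 Var[id; μ].toNNReal) t)) := by
  set c := ∫ y, y ∂μ with hc
  have hi : Integrable (fun x : ℝ => x) μ := hμ.integrable (by norm_num)
  rcases eq_or_ne Var[id; μ] 0 with h | h
  -- With zero variance standardisation is impossible, but the centred law is then the point mass
  -- `N(0,0)` itself.
  · have h1 : μ.map (fun x => x - c) = Measure.dirac 0 := by
      have : (fun x => x - c) =ᵐ[μ] fun _ => 0 := by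
        filter_upwards [ae_eq_integral_of_variance_eq_zero hμ h] with x hx
        simp only [id] at hx
        simp [hc, ← hx]
      rw [Measure.map_congr this, Measure.map_const]
      simp
    rw [h1, h]
    simp
  · have hv : 0 < Var[id; μ] := lt_of_le_of_ne (variance_nonneg _ _) h.symm
    have key := tendsto_charFun_inv_sqrt_mul_pow (P := μ)
      (X := fun x => (√Var[id; μ])⁻¹ * (x - c)) (by fun_prop) ?_ ?_ (√Var[id; μ] * t)
    · convert! key using 2 with n
      · congr 1
        rw [charFun_map_mul_comp (by fun_prop)]
        congr 1
        field_simp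
      · rw [charFun_gaussianReal]
        congr 1
        rw [Real.coe_toNNReal _ hv.le]
        have : ((√Var[id; μ] : ℝ) : ℂ) ^ 2 = (Var[id; μ] : ℝ) := by
          rw [← Complex.ofReal_pow, Real.sq_sqrt hv.le]
        push_cast
        rw [mul_pow, this]
        simp
        ring
    · rw [integral_const_mul, integral_sub hi (by fun_prop)]
      simp [hc]
    · simp only [Pi.pow_apply, mul_pow]
      rw [integral_const_mul, inv_pow, Real.sq_sqrt hv.le, variance_eq_integral (by fun_prop)]
      have : ∫ x, (id x - ∫ y, id y ∂μ) ^ 2 ∂μ ≠ 0 := by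
        rw [← variance_eq_integral (by fun_prop)]; exact h
      exact inv_mul_cancel₀ this

/-- Convergence of the powers of the characteristic function of the centred tilted weight. -/
lemma tendsto_integral_normWeight_pow {ν : Measure EReal} (hν : WeightAssumption ν) {β : ℝ}
    (hβ : 0 < β) (t : ℝ) :
    Tendsto (fun n : ℕ => (∫ x, normWeight ν β x •
        Complex.exp ((t * (x.toReal + deriv (psi ν) β) / √n : ℝ) * Complex.I) ∂ν) ^ n) atTop
      (𝓝 (charFun (gaussianReal 0 (deriv (deriv (psi ν)) β).toNNReal) t)) := by
  have := isProbabilityMeasure_tiltedLaw hν hβ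
  -- The argument is `-t` because `tiltedLaw` describes `-ω`; the symmetry of the centred Gaussian
  -- absorbs the sign.
  have key := tendsto_charFun_sub_mean_pow (memLp_tiltedLaw hν hβ) (-t)
  rw [variance_tiltedLaw hν hβ, integral_tiltedLaw hν hβ] at key
  convert! key using 2 with n
  · congr 1
    rw [charFun_apply_real, integral_map (by fun_prop) (by fun_prop),
      ← integral_normWeight_smul hν hβ (by fun_prop)]
    congr 1 with x
    congr 3
    push_cast
    ring
  · rw [charFun_gaussianReal, charFun_gaussianReal]
    simp

/-! ### Second moments of polynomials in independent variables -/

section Chaos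

open scoped ComplexConjugate

variable {X E : Type*} [Fintype E]

open Classical in
-- Padding with factors `1` gives a product over all of `E`, the form to which Fubini for
-- `Measure.pi` applies.
lemma prod_mul_conj_prod_eq (ζ : X → ℂ) (Γ Δ : Finset E) (x : E → X) :
    (∏ e ∈ Γ, ζ (x e)) * conj (∏ e ∈ Δ, ζ (x e)) =
      ∏ e, (fun e y => (if e ∈ Γ then ζ y else 1) * (if e ∈ Δ then conj (ζ y) else 1)) e (x e) := by
  rw [Finset.prod_mul_distrib, map_prod]
  simp

/-- The uniform average over `S` of the products of `g` along the configurations. -/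
def avgProd (S : Finset (Finset E)) (g : X → ℂ) (x : E → X) : ℂ :=
  (∑ π ∈ S, ∏ e ∈ π, g (x e)) / (S.card : ℂ)

/-- Expand `g = 1 + (g - 1)` along each `π` and exchange the sums: the monomial of `Γ` is counted
once for each `π` containing `Γ`. -/
lemma avgProd_eq_sum (S : Finset (Finset E)) (g : X → ℂ) (x : E → X) :
    avgProd S g x = ∑ Γ, (inclProb S Γ : ℂ) * ∏ e ∈ Γ, (g (x e) - 1) := by
  classical
  have h : ∀ π : Finset E, ∏ e ∈ π, g (x e) =
      ∑ Γ, if Γ ⊆ π then ∏ e ∈ Γ, (g (x e) - 1) else 0 := by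
    intro π
    rw [← Finset.sum_filter]
    have : Finset.univ.filter (fun Γ => Γ ⊆ π) = π.powerset := by
      ext Γ; simp
    rw [this, ← Finset.prod_one_add]
    exact Finset.prod_congr rfl fun e _ => by ring
  simp_rw [avgProd, h]
  rw [Finset.sum_comm, Finset.sum_div]
  refine Finset.sum_congr rfl fun Γ _ => ?_
  rw [← Finset.sum_filter, Finset.sum_const, inclProb, nsmul_eq_mul]
  push_cast
  rw [mul_div_right_comm]

variable [MeasurableSpace X] {ν : Measure X}

lemma integrable_mul_conj {u v : X → ℂ} (hu : MemLp u 2 ν) (hv : MemLp v 2 ν) :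
    Integrable (fun y => u y * conj (v y)) ν :=
  hu.integrable_mul (q := 2) hv.star

lemma integral_normSq_complex (u : X → ℂ) :
    ∫ y, u y * conj (u y) ∂ν = ((∫ y, ‖u y‖ ^ 2 ∂ν : ℝ) : ℂ) := by
  rw [← integral_complex_ofReal]
  congr 1 with y
  rw [RCLike.mul_conj]
  simp

variable [IsProbabilityMeasure ν]

open Classical in
lemma integrable_prod_mul_conj_prod {ζ : X → ℂ} (hζ : MemLp ζ 2 ν) (Γ Δ : Finset E) :
    Integrable (fun x : E → X => (∏ e ∈ Γ, ζ (x e)) * conj (∏ e ∈ Δ, ζ (x e)))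
      (Measure.pi fun _ => ν) := by
  simp_rw [prod_mul_conj_prod_eq]
  refine Integrable.fintype_prod (μ := fun _ : E => ν) (f := fun e y =>
    (if e ∈ Γ then ζ y else 1) * (if e ∈ Δ then conj (ζ y) else 1)) fun e => ?_
  have h1 : Integrable ζ ν := hζ.integrable (by norm_num)
  by_cases h : e ∈ Γ <;> by_cases h' : e ∈ Δ <;> simp only [h, h', if_true, if_false, mul_one,
    one_mul]
  · exact integrable_mul_conj hζ hζ
  · exact h1
  · exact hζ.star.integrable (by norm_num)
  · exact integrable_const _

open Classical in
lemma integral_prod_mul_conj_prod {ζ : X → ℂ} (h0 : ∫ y, ζ y ∂ν = 0)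
    (Γ Δ : Finset E) :
    ∫ x : E → X, (∏ e ∈ Γ, ζ (x e)) * conj (∏ e ∈ Δ, ζ (x e)) ∂(Measure.pi fun _ => ν) =
      if Γ = Δ then (((∫ y, ‖ζ y‖ ^ 2 ∂ν) ^ Γ.card : ℝ) : ℂ) else 0 := by
  simp_rw [prod_mul_conj_prod_eq]
  rw [integral_fintype_prod_eq_prod (μ := fun _ : E => ν) fun e y =>
    (if e ∈ Γ then ζ y else 1) * (if e ∈ Δ then conj (ζ y) else 1)]
  split_ifs with h
  · subst h
    have : ∀ e, ∫ y, ((if e ∈ Γ then ζ y else 1) * (if e ∈ Γ then conj (ζ y) else 1)) ∂ν =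
        if e ∈ Γ then ((∫ y, ‖ζ y‖ ^ 2 ∂ν : ℝ) : ℂ) else 1 := by
      intro e
      by_cases h : e ∈ Γ
      · simp only [h, if_true, integral_normSq_complex]
      · simp [h]
    simp_rw [this]
    simp
  -- An edge lying in exactly one of the two sets contributes the factor `∫ ζ = 0` or its conjugate.
  · obtain ⟨e, he⟩ : ∃ e, ¬ (e ∈ Γ ↔ e ∈ Δ) := by
      by_contra! hc
      exact h (Finset.ext hc)
    refine Finset.prod_eq_zero (Finset.mem_univ e) ?_
    by_cases h : e ∈ Γ <;> by_cases h' : e ∈ Δ <;> simp [h, h'] at he ⊢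
    · exact h0
    · rw [integral_conj, h0, map_zero]

/-- Orthogonality of the monomials in independent centred variables. -/
lemma integral_norm_sq_sum_prod {ζ : X → ℂ} (hζ : MemLp ζ 2 ν) (h0 : ∫ y, ζ y ∂ν = 0)
    (c : Finset E → ℝ) :
    ∫ x : E → X, ‖∑ Γ, (c Γ : ℂ) * ∏ e ∈ Γ, ζ (x e)‖ ^ 2 ∂(Measure.pi fun _ => ν) =
      ∑ Γ, c Γ ^ 2 * (∫ y, ‖ζ y‖ ^ 2 ∂ν) ^ Γ.card := by
  classical
  apply Complex.ofReal_injective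
  rw [← integral_normSq_complex (ν := Measure.pi fun _ : E => ν)]
  have : ∀ x : E → X, (∑ Γ, (c Γ : ℂ) * ∏ e ∈ Γ, ζ (x e)) *
      conj (∑ Γ, (c Γ : ℂ) * ∏ e ∈ Γ, ζ (x e)) =
      ∑ Γ, ∑ Δ, ((c Γ * c Δ : ℝ) : ℂ) * ((∏ e ∈ Γ, ζ (x e)) * conj (∏ e ∈ Δ, ζ (x e))) := by
    intro x
    rw [map_sum, Finset.sum_mul_sum]
    refine Finset.sum_congr rfl fun Γ _ => Finset.sum_congr rfl fun Δ _ => ?_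
    rw [map_mul, Complex.conj_ofReal]
    push_cast
    ring
  simp_rw [this]
  have hi := fun Γ Δ : Finset E => (integrable_prod_mul_conj_prod hζ Γ Δ).const_mul
    ((c Γ * c Δ : ℝ) : ℂ)
  rw [integral_finsetSum _ fun Γ _ => integrable_finsetSum _ fun Δ _ => hi Γ Δ]
  rw [Complex.ofReal_sum]
  refine Finset.sum_congr rfl fun Γ _ => ?_
  rw [integral_finsetSum _ fun Δ _ => hi Γ Δ]
  simp_rw [integral_const_mul, integral_prod_mul_conj_prod h0]
  simp [sq]

lemma memLp_prod {u : X → ℂ} (hm : Measurable u) (hu : MemLp u 2 ν) (Γ : Finset E) :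
    MemLp (fun x : E → X => ∏ e ∈ Γ, u (x e)) 2 (Measure.pi fun _ => ν) := by
  have h : Measurable fun x : E → X => ∏ e ∈ Γ, u (x e) :=
    Finset.measurable_fun_prod _ fun e _ => hm.comp (measurable_pi_apply e)
  rw [memLp_two_iff_integrable_sq_norm h.aestronglyMeasurable]
  refine (integrable_prod_mul_conj_prod hu Γ Γ).norm.congr ?_
  filter_upwards with x
  rw [norm_mul, RCLike.norm_conj, sq]

lemma integral_norm_sq_prod_sub_prod {u v : X → ℂ}
    (hu : MemLp u 2 ν) (hv : MemLp v 2 ν) :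
    ∫ x : E → X, ‖∏ e, u (x e) - ∏ e, v (x e)‖ ^ 2 ∂(Measure.pi fun _ => ν) =
      (∫ y, ‖u y‖ ^ 2 ∂ν) ^ Fintype.card E
        - 2 * ((∫ y, u y * conj (v y) ∂ν) ^ Fintype.card E).re
        + (∫ y, ‖v y‖ ^ 2 ∂ν) ^ Fintype.card E := by
  have h : ∀ x : E → X, ‖∏ e, u (x e) - ∏ e, v (x e)‖ ^ 2 =
      ∏ e, ‖u (x e)‖ ^ 2 - 2 * (∏ e, u (x e) * conj (v (x e))).re + ∏ e, ‖v (x e)‖ ^ 2 := by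
    intro x
    rw [Finset.prod_mul_distrib, ← map_prod, Finset.prod_pow, Finset.prod_pow, ← norm_prod,
      ← norm_prod, ← Complex.normSq_eq_norm_sq, ← Complex.normSq_eq_norm_sq,
      ← Complex.normSq_eq_norm_sq, Complex.normSq_sub]
    ring
  simp_rw [h]
  have iu : Integrable (fun x : E → X => ∏ e, ‖u (x e)‖ ^ 2) (Measure.pi fun _ => ν) :=
    Integrable.fintype_prod (f := fun _ y => ‖u y‖ ^ 2) fun _ =>
      (memLp_two_iff_integrable_sq_norm hu.1).1 hu
  have iv : Integrable (fun x : E → X => ∏ e, ‖v (x e)‖ ^ 2) (Measure.pi fun _ => ν) :=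
    Integrable.fintype_prod (f := fun _ y => ‖v y‖ ^ 2) fun _ =>
      (memLp_two_iff_integrable_sq_norm hv.1).1 hv
  have iuv : Integrable (fun x : E → X => ∏ e, u (x e) * conj (v (x e)))
      (Measure.pi fun _ => ν) :=
    Integrable.fintype_prod (f := fun _ y => u y * conj (v y)) fun _ => integrable_mul_conj hu hv
  have hre : ∫ x : E → X, (∏ e, u (x e) * conj (v (x e))).re ∂(Measure.pi fun _ => ν) =
      ((∫ y, u y * conj (v y) ∂ν) ^ Fintype.card E).re := by
    rw [← integral_fintype_prod_eq_pow]
    exact integral_re iuv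
  have ire : Integrable (fun x : E → X => 2 * (∏ e, u (x e) * conj (v (x e))).re)
      (Measure.pi fun _ => ν) := iuv.re.const_mul 2
  rw [integral_add (f := fun x : E → X => ∏ e, ‖u (x e)‖ ^ 2 -
      2 * (∏ e, u (x e) * conj (v (x e))).re) (iu.sub ire) iv, integral_sub iu ire,
    integral_const_mul, hre,
    integral_fintype_prod_eq_pow (fun y => ‖u y‖ ^ 2),
    integral_fintype_prod_eq_pow (fun y => ‖v y‖ ^ 2)]

/-- The distance in `L²` of the average of products from the product with independent inclusion
of the edges. -/
lemma integral_norm_sq_avgProd_sub (S : Finset (Finset E)) {g : X → ℂ} (hg : MemLp g 2 ν)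
    (h1 : ∫ y, g y ∂ν = 1) (p : ℝ) :
    ∫ x : E → X, ‖avgProd S g x - ∏ e, (1 + (p : ℂ) * (g (x e) - 1))‖ ^ 2
        ∂(Measure.pi fun _ => ν) =
      ∑ Γ, (inclProb S Γ - p ^ Γ.card) ^ 2 * (∫ y, ‖g y - 1‖ ^ 2 ∂ν) ^ Γ.card := by
  rw [← integral_norm_sq_sum_prod (ζ := fun y => g y - 1) (hg.sub (memLp_const 1))]
  · congr 1 with x
    congr 2
    rw [avgProd_eq_sum, Finset.prod_one_add, Finset.powerset_univ, ← Finset.sum_sub_distrib]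
    refine Finset.sum_congr rfl fun Γ _ => ?_
    rw [Finset.prod_mul_distrib, Finset.prod_const]
    push_cast
    ring
  · rw [integral_sub (hg.integrable (by norm_num)) (by fun_prop), h1]
    simp

end Chaos

/-! ### Inclusion probabilities are close to those of independent edges -/

section Inclusion

lemma sum_pow_card {E : Type*} [Fintype E] (r : ℝ) :
    ∑ Γ : Finset E, r ^ Γ.card = (1 + r) ^ Fintype.card E := by
  have := Finset.prod_one_add (f := fun _ : E => r) Finset.univ
  rw [Finset.powerset_univ] at this
  simpa using this.symm

lemma sum_biUnion_le_sum {ι κ : Type*} [DecidableEq κ] (s : Finset ι) (t : ι → Finset κ)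
    {f : κ → ℝ} (hf : ∀ k, 0 ≤ f k) : ∑ k ∈ s.biUnion t, f k ≤ ∑ i ∈ s, ∑ k ∈ t i, f k := by
  classical
  induction s using Finset.cons_induction with
  | empty => simp
  | cons a s ha ih =>
    rw [Finset.cons_eq_insert, Finset.biUnion_insert, Finset.sum_insert ha]
    have := Finset.sum_union_inter (s₁ := t a) (s₂ := s.biUnion t) (f := f)
    have h0 : 0 ≤ ∑ k ∈ t a ∩ s.biUnion t, f k := Finset.sum_nonneg fun k _ => hf k
    linarith

open Classical in
-- Removing `e` and `f` is injective on the sets that contain both, and costs the factor `r²`.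
lemma sum_pow_card_pair_le {E : Type*} [Fintype E] {r : ℝ} (hr : 0 ≤ r) {e f : E} (hef : e ≠ f) :
    ∑ Γ : Finset E with e ∈ Γ ∧ f ∈ Γ, r ^ Γ.card ≤ r ^ 2 * (1 + r) ^ Fintype.card E := by
  have h1 : ∀ Γ ∈ Finset.univ.filter (fun Γ : Finset E => e ∈ Γ ∧ f ∈ Γ),
      r ^ Γ.card = r ^ 2 * r ^ (Γ \ {e, f}).card := by
    intro Γ hΓ
    have hs : ({e, f} : Finset E) ⊆ Γ := by
      simp only [Finset.mem_filter, Finset.mem_univ, true_and] at hΓ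
      simp [Finset.insert_subset_iff, hΓ]
    rw [← pow_add, Finset.card_sdiff_of_subset hs, Finset.card_pair hef]
    have := Finset.card_le_card hs
    rw [Finset.card_pair hef] at this
    congr 1
    omega
  rw [Finset.sum_congr rfl h1, ← Finset.mul_sum, ← sum_pow_card]
  refine mul_le_mul_of_nonneg_left ?_ (by positivity)
  rw [← Finset.sum_image (f := fun Γ : Finset E => r ^ Γ.card) (g := fun Γ => Γ \ {e, f})]
  · exact Finset.sum_le_sum_of_subset_of_nonneg (Finset.subset_univ _) fun _ _ _ => by positivity
  · intro Γ hΓ Δ hΔ h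
    simp only [Finset.coe_filter, Finset.mem_univ, true_and, Set.mem_ofPred_eq] at hΓ hΔ
    ext g
    have := Finset.ext_iff.1 h g
    by_cases h1 : g = e
    · simp [h1, hΓ, hΔ]
    · by_cases h2 : g = f
      · simp [h2, hΓ, hΔ]
      · simpa [h1, h2] using this

variable {V : Type*} [Finite V] {G : SimpleGraph V} [Fintype G.edgeSet]

open Classical in
/-- Union bound over the pairs of adjacent edges. -/
lemma sum_pow_card_not_isPartialMatching_le {r : ℝ} (hr : 0 ≤ r) :
    ∑ Γ : Finset G.edgeSet with ¬ IsPartialMatching Γ, r ^ Γ.card ≤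
      (Nat.card V : ℝ) ^ 3 * (r ^ 2 * (1 + r) ^ Fintype.card G.edgeSet) := by
  have := Fintype.ofFinite V
  -- A triple lists a shared vertex and the other endpoints of two edges of `Γ` meeting there; this
  -- is the source of the factor `|V|³`.
  let P : V × V × V → Finset G.edgeSet → Prop := fun z Γ =>
    ∃ e ∈ Γ, ∃ f ∈ Γ, e ≠ f ∧ (e : Sym2 V) = s(z.1, z.2.1) ∧ (f : Sym2 V) = s(z.1, z.2.2)
  have hsub : Finset.univ.filter (fun Γ : Finset G.edgeSet => ¬ IsPartialMatching Γ) ⊆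
      Finset.univ.biUnion fun z => Finset.univ.filter (P z) := by
    intro Γ hΓ
    rw [Finset.mem_filter, IsPartialMatching] at hΓ
    replace hΓ := hΓ.2
    push Not at hΓ
    obtain ⟨e, he, f, hf, hef, v, hve, hvf⟩ := hΓ
    obtain ⟨x, hx⟩ := Sym2.mem_iff_exists.1 hve
    obtain ⟨y, hy⟩ := Sym2.mem_iff_exists.1 hvf
    simp only [Finset.mem_biUnion, Finset.mem_univ, true_and, Finset.mem_filter]
    exact ⟨(v, x, y), e, he, f, hf, hef, hx, hy⟩
  have hP : ∀ z, ∑ Γ : Finset G.edgeSet with P z Γ, r ^ Γ.card ≤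
      r ^ 2 * (1 + r) ^ Fintype.card G.edgeSet := by
    intro z
    by_cases h : ∃ e f : G.edgeSet, e ≠ f ∧ (e : Sym2 V) = s(z.1, z.2.1) ∧
        (f : Sym2 V) = s(z.1, z.2.2)
    · obtain ⟨e, f, hef, he, hf⟩ := h
      refine le_trans (Finset.sum_le_sum_of_subset_of_nonneg ?_ fun _ _ _ => by positivity)
        (sum_pow_card_pair_le hr hef)
      intro Γ hΓ
      simp only [Finset.mem_filter, Finset.mem_univ, true_and, P] at hΓ ⊢
      obtain ⟨e', he', f', hf', -, h1, h2⟩ := hΓ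
      rw [Subtype.ext (he.trans h1.symm), Subtype.ext (hf.trans h2.symm)]
      exact ⟨he', hf'⟩
    · rw [Finset.sum_eq_zero]
      · positivity
      · intro Γ hΓ
        simp only [Finset.mem_filter, Finset.mem_univ, true_and, P] at hΓ
        obtain ⟨e', he', f', hf', hne, h1, h2⟩ := hΓ
        exact absurd ⟨e', f', hne, h1, h2⟩ h
  calc _ ≤ ∑ Γ ∈ Finset.univ.biUnion fun z => Finset.univ.filter (P z), r ^ Γ.card :=
        Finset.sum_le_sum_of_subset_of_nonneg hsub fun _ _ _ => by positivity
    _ ≤ ∑ z, ∑ Γ : Finset G.edgeSet with P z Γ, r ^ Γ.card :=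
        sum_biUnion_le_sum _ _ fun _ => by positivity
    _ ≤ ∑ z : V × V × V, r ^ 2 * (1 + r) ^ Fintype.card G.edgeSet :=
        Finset.sum_le_sum fun z _ => hP z
    _ = _ := by
        simp only [Finset.sum_const, Finset.card_univ, Fintype.card_prod, nsmul_eq_mul,
          Nat.card_eq_fintype_card]
        push_cast
        ring

/-- Partial matchings have relative error `ρ^|Γ| / √M`. For other sets no cancellation is sought:
`inclProb` and `p^|Γ|` are both at most `((1 + ρ') p)^|Γ|`, and the sets containing two adjacent
edges are few in the weighted sense. -/
lemma sum_sq_inclProb_sub_le {S : Finset (Finset G.edgeSet)} {p ρ ρ' M A : ℝ} (hp : 0 < p)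
    (hρ' : 0 ≤ ρ') (hA : 0 ≤ A) (hM : 0 ≤ M) (hS : ∀ e : G.edgeSet, inclProb S {e} = p)
    (hmatch : ∀ Γ : Finset G.edgeSet, IsPartialMatching Γ →
      |inclProb S Γ / ∏ e ∈ Γ, inclProb S {e} - 1| ≤ ρ ^ Γ.card / √M)
    (hnon : ∀ Γ : Finset G.edgeSet, (∃ π ∈ S, Γ ⊆ π) → ¬ IsPartialMatching Γ →
      inclProb S Γ ≤ ρ' ^ Γ.card * ∏ e ∈ Γ, inclProb S {e}) :
    ∑ Γ, (inclProb S Γ - p ^ Γ.card) ^ 2 * A ^ Γ.card ≤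
      (1 + ρ ^ 2 * p ^ 2 * A) ^ Fintype.card G.edgeSet / M +
      (Nat.card V : ℝ) ^ 3 * (((1 + ρ') ^ 2 * p ^ 2 * A) ^ 2 *
        (1 + (1 + ρ') ^ 2 * p ^ 2 * A) ^ Fintype.card G.edgeSet) := by
  classical
  have hterm : ∀ Γ : Finset G.edgeSet, (inclProb S Γ - p ^ Γ.card) ^ 2 * A ^ Γ.card ≤
      (ρ ^ 2 * p ^ 2 * A) ^ Γ.card / M +
        if ¬ IsPartialMatching Γ then ((1 + ρ') ^ 2 * p ^ 2 * A) ^ Γ.card else 0 := by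
    intro Γ
    have hpk : 0 < p ^ Γ.card := by positivity
    simp only [hS, Finset.prod_const] at hmatch hnon
    by_cases h : IsPartialMatching Γ
    · simp only [h, not_true_eq_false, if_false, add_zero]
      have h1 := hmatch Γ h
      have h2 : inclProb S Γ - p ^ Γ.card = p ^ Γ.card * (inclProb S Γ / p ^ Γ.card - 1) := by
        field_simp
      have h3 : (inclProb S Γ / p ^ Γ.card - 1) ^ 2 ≤ (ρ ^ Γ.card / √M) ^ 2 :=
        sq_le_sq' (abs_le.1 h1).1 (abs_le.1 h1).2
      rw [div_pow, Real.sq_sqrt hM] at h3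
      calc _ = (inclProb S Γ / p ^ Γ.card - 1) ^ 2 * ((p ^ Γ.card) ^ 2 * A ^ Γ.card) := by
            rw [h2]; ring
        _ ≤ (ρ ^ Γ.card) ^ 2 / M * ((p ^ Γ.card) ^ 2 * A ^ Γ.card) := by gcongr
        _ = _ := by
          rw [mul_pow, mul_pow, ← pow_mul, ← pow_mul, ← pow_mul, ← pow_mul, mul_comm Γ.card 2]
          ring
    · simp only [h, not_false_eq_true, if_true]
      have h0 : 0 ≤ (ρ ^ 2 * p ^ 2 * A) ^ Γ.card / M := by positivity
      refine le_trans ?_ (le_add_of_nonneg_left h0)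
      have hq0 : 0 ≤ inclProb S Γ := by unfold inclProb; positivity
      have hq : inclProb S Γ ≤ ρ' ^ Γ.card * p ^ Γ.card := by
        by_cases hex : ∃ π ∈ S, Γ ⊆ π
        · exact hnon Γ hex h
        · have : inclProb S Γ = 0 := by
            push Not at hex
            simp only [inclProb, div_eq_zero_iff, Nat.cast_eq_zero, Finset.card_eq_zero,
              Finset.filter_eq_empty_iff]
            exact Or.inl hex
          rw [this]; positivity
      have h1 : ρ' ^ Γ.card ≤ (1 + ρ') ^ Γ.card := by gcongr; linarith
      have h2 : 1 ≤ (1 + ρ') ^ Γ.card := one_le_pow₀ (by linarith)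
      have h3 : (inclProb S Γ - p ^ Γ.card) ^ 2 ≤ ((1 + ρ') ^ Γ.card * p ^ Γ.card) ^ 2 := by
        refine sq_le_sq' ?_ ?_ <;> nlinarith
      calc _ ≤ ((1 + ρ') ^ Γ.card * p ^ Γ.card) ^ 2 * A ^ Γ.card := by gcongr
        _ = _ := by
          rw [mul_pow, mul_pow, mul_pow, ← pow_mul, ← pow_mul, ← pow_mul, ← pow_mul,
            mul_comm Γ.card 2]
  refine (Finset.sum_le_sum fun Γ _ => hterm Γ).trans ?_
  rw [Finset.sum_add_distrib, ← Finset.sum_div, sum_pow_card, ← Finset.sum_filter]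
  gcongr
  exact sum_pow_card_not_isPartialMatching_le (by positivity)

end Inclusion

/-! ### Orders of magnitude of the graphs and of the inclusion errors. -/

section Asymptotics

variable {V : ℕ → Type*} {G : ∀ n, SimpleGraph (V n)}
  {S : ∀ n, Finset (Finset (G n).edgeSet)} {m : ℕ → ℕ}

lemma tendsto_card_vertices (hG : GraphAssumption G) (hS : FamilyAssumption G S m) :
    Tendsto (fun n => (Nat.card (V n) : ℝ)) atTop atTop := by
  obtain ⟨c, hc⟩ := hG.card_vertices
  obtain ⟨γ, hγ, hlim⟩ := hS.gamma
  -- If `c = 0` there are eventually no edges, and division by zero makes the ratio in `gamma`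
  -- vanish, against `γ > 0`.
  have hc0 : c ≠ 0 := by
    rintro rfl
    obtain ⟨C, hC⟩ := hG.card_edges.1.bound
    have : Tendsto (fun n => (m n : ℝ) ^ 2 / (2 * (Nat.card (G n).edgeSet : ℝ))) atTop (𝓝 0) := by
      refine tendsto_const_nhds.congr' ?_
      filter_upwards [hc, hC] with n h1 h2
      rw [h1] at h2
      have h3 : (Nat.card (G n).edgeSet : ℝ) = 0 := by
        rw [← norm_le_zero_iff]; simpa using h2
      rw [h3]; simp
    exact hγ.ne (tendsto_nhds_unique this hlim)
  have h : Tendsto (fun n : ℕ => (c : ℝ) * n) atTop atTop :=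
    tendsto_natCast_atTop_atTop.const_mul_atTop (by positivity)
  refine h.congr' ?_
  filter_upwards [hc] with n hn
  rw [hn]; push_cast; ring

lemma exists_card_edges_ge (hG : GraphAssumption G) :
    ∃ κ : ℝ, 0 < κ ∧ ∀ᶠ n in atTop,
      κ * (Nat.card (V n) : ℝ) ^ 2 ≤ (Nat.card (G n).edgeSet : ℝ) := by
  obtain ⟨C, hC0, hC⟩ := hG.card_edges.2.exists_pos
  refine ⟨C⁻¹, by positivity, ?_⟩
  filter_upwards [hC.bound] with n hn
  rw [inv_mul_le_iff₀ hC0]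
  simpa using hn

lemma tendsto_card_edges (hG : GraphAssumption G) (hS : FamilyAssumption G S m) :
    Tendsto (fun n => (Nat.card (G n).edgeSet : ℝ)) atTop atTop := by
  obtain ⟨κ, hκ, h⟩ := exists_card_edges_ge hG
  refine tendsto_atTop_mono' _ h ?_
  exact ((tendsto_pow_atTop two_ne_zero).comp (tendsto_card_vertices hG hS)).const_mul_atTop hκ

/-- The probability of an edge to be contained in a uniform configuration. -/
def edgeProb (G : ∀ n, SimpleGraph (V n)) (m : ℕ → ℕ) (n : ℕ) : ℝ :=
  (m n : ℝ) / (Nat.card (G n).edgeSet : ℝ)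

lemma edgeProb_nonneg (n : ℕ) : 0 ≤ edgeProb G m n := by unfold edgeProb; positivity

/-- The quantity is `m² / |E|`, which tends to `2γ`. This bound keeps every power with exponent
`|E|` under control. -/
lemma exists_edgeProb_sq_mul_le (hG : GraphAssumption G) (hS : FamilyAssumption G S m) :
    ∃ B : ℝ, 0 < B ∧ ∀ᶠ n in atTop, edgeProb G m n ^ 2 * (Nat.card (G n).edgeSet : ℝ) ≤ B := by
  obtain ⟨γ, hγ, hlim⟩ := hS.gamma
  refine ⟨2 * (γ + 1), by positivity, ?_⟩
  filter_upwards [hlim.eventually (gt_mem_nhds (lt_add_one γ)),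
    (tendsto_card_edges hG hS).eventually_gt_atTop 0] with n h1 h2
  rw [edgeProb]
  rw [div_lt_iff₀ (by positivity)] at h1
  rw [div_pow, div_mul_eq_mul_div, div_le_iff₀ (by positivity)]
  nlinarith

lemma tendsto_edgeProb (hG : GraphAssumption G) (hS : FamilyAssumption G S m) :
    Tendsto (edgeProb G m) atTop (𝓝 0) := by
  obtain ⟨B, hB, h⟩ := exists_edgeProb_sq_mul_le hG hS
  have hN := tendsto_card_edges hG hS
  have h2 : Tendsto (fun n => edgeProb G m n ^ 2) atTop (𝓝 0) := by
    refine squeeze_zero' (.of_forall fun n => by positivity) ?_ (hN.const_div_atTop B)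
    filter_upwards [h, hN.eventually_gt_atTop 0] with n h1 h3
    rwa [le_div_iff₀ h3]
  have h3 := h2.sqrt
  rw [Real.sqrt_zero] at h3
  refine h3.congr fun n => Real.sqrt_sq (edgeProb_nonneg n)

lemma tendsto_size (hG : GraphAssumption G) (hS : FamilyAssumption G S m) :
    Tendsto m atTop atTop := by
  obtain ⟨γ, hγ, hlim⟩ := hS.gamma
  have hN := tendsto_card_edges hG hS
  have h : Tendsto (fun n => (m n : ℝ) ^ 2) atTop atTop := by
    refine (hlim.pos_mul_atTop hγ (hN.const_mul_atTop (two_pos (α := ℝ)))).congr' ?_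
    filter_upwards [hN.eventually_gt_atTop 0] with n h3
    field_simp
  have h2 : Tendsto (fun n => (m n : ℝ)) atTop atTop := by
    refine (Real.tendsto_sqrt_atTop.comp h).congr fun n => ?_
    simp
  exact tendsto_natCast_atTop_iff.1 h2

/-- Matchings contribute `O(1/m)`. The rest contributes `O(|V|³ p⁴)`, which is `O(1/|V|)` because
`p² = O(1/|E|) = O(|V|⁻²)`. -/
lemma tendsto_sum_sq_inclProb_sub [∀ n, Finite (V n)] [∀ n, Fintype (G n).edgeSet]
    (hG : GraphAssumption G) (hS : FamilyAssumption G S m) {A : ℝ} (hA : 0 ≤ A) :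
    Tendsto (fun n => ∑ Γ, (inclProb (S n) Γ - edgeProb G m n ^ Γ.card) ^ 2 * A ^ Γ.card) atTop
      (𝓝 0) := by
  obtain ⟨ρ, hρ, hmatch⟩ := hS.matching
  obtain ⟨ρ', hρ', hnon⟩ := hS.nonmatching
  obtain ⟨B, hB, hpB⟩ := exists_edgeProb_sq_mul_le hG hS
  obtain ⟨κ, hκ, hcard⟩ := exists_card_edges_ge hG
  have hV := tendsto_card_vertices hG hS
  have hN := tendsto_card_edges hG hS
  have hm : Tendsto (fun n => (m n : ℝ)) atTop atTop :=
    tendsto_natCast_atTop_atTop.comp (tendsto_size hG hS)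
  set K := (1 + ρ') ^ 2 * A with hK
  have hpow : ∀ (n : ℕ) (L : ℝ), 0 ≤ L →
      edgeProb G m n ^ 2 * (Nat.card (G n).edgeSet : ℝ) ≤ B →
      (1 + L * edgeProb G m n ^ 2) ^ Fintype.card (G n).edgeSet ≤ Real.exp (L * B) := by
    intro n L hL h
    rw [Nat.card_eq_fintype_card] at h
    calc (1 + L * edgeProb G m n ^ 2) ^ Fintype.card (G n).edgeSet
        ≤ Real.exp (L * edgeProb G m n ^ 2) ^ Fintype.card (G n).edgeSet := by
          gcongr
          rw [add_comm]
          exact Real.add_one_le_exp _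
      _ = Real.exp (L * (edgeProb G m n ^ 2 * (Fintype.card (G n).edgeSet : ℝ))) := by
          rw [← Real.exp_nat_mul]; congr 1; ring
      _ ≤ _ := by gcongr
  have hlim : Tendsto (fun n => Real.exp (ρ ^ 2 * A * B) / (m n : ℝ) +
      (κ⁻¹ ^ 2 * (K * B) ^ 2 * Real.exp (K * B)) / (Nat.card (V n) : ℝ)) atTop (𝓝 (0 + 0)) :=
    (hm.const_div_atTop _).add (hV.const_div_atTop _)
  rw [add_zero] at hlim
  refine squeeze_zero' (.of_forall fun n => Finset.sum_nonneg fun _ _ => by positivity) ?_ hlim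
  filter_upwards [hmatch, hnon, hpB, hcard, hV.eventually_gt_atTop 0, hN.eventually_gt_atTop 0,
    hm.eventually_gt_atTop 0, hS.edge_prob] with n h1 h2 h3 h4 hV0 hN0 hm0 h5
  have hp : 0 < edgeProb G m n := by unfold edgeProb; positivity
  refine (sum_sq_inclProb_sub_le hp hρ'.le hA hm0.le h5 h1 h2).trans (add_le_add ?_ ?_)
  · gcongr
    rw [mul_right_comm]
    exact hpow n _ (by positivity) h3
  · rw [mul_right_comm ((1 + ρ') ^ 2), ← hK]
    have h6 : K * edgeProb G m n ^ 2 ≤ K * B / (κ * (Nat.card (V n) : ℝ) ^ 2) := by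
      rw [le_div_iff₀ (by positivity), mul_assoc]
      gcongr
      exact (mul_le_mul_of_nonneg_left h4 (by positivity)).trans h3
    calc _ ≤ (Nat.card (V n) : ℝ) ^ 3 * ((K * B / (κ * (Nat.card (V n) : ℝ) ^ 2)) ^ 2 *
          Real.exp (K * B)) := by
          gcongr
          exact hpow n _ (by positivity) h3
      _ = _ := by
          field_simp

end Asymptotics

/-! ### Comparison with independent edges -/

/-- The inclusion probabilities of `S n` are, in a weighted square-summable sense, close to those
of sets containing each edge independently with probability `p n`. -/
structure IsAlmostIndependent {E : ℕ → Type*} [∀ n, Fintype (E n)]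
    (S : ∀ n, Finset (Finset (E n))) (p : ℕ → ℝ) : Prop where
  nonneg : ∀ n, 0 ≤ p n
  tendsto_zero : Tendsto p atTop (𝓝 0)
  exists_bound : ∃ B : ℝ, 0 < B ∧ ∀ᶠ n in atTop, p n ^ 2 * (Fintype.card (E n) : ℝ) ≤ B
  tendsto_sum : ∀ A : ℝ, 0 ≤ A →
    Tendsto (fun n => ∑ Γ, (inclProb (S n) Γ - p n ^ Γ.card) ^ 2 * A ^ Γ.card) atTop (𝓝 0)

section Comparison

open scoped ComplexConjugate

lemma norm_pow_sub_pow_le {α β : ℂ} {M : ℝ} (hM : 1 ≤ M) (hα : ‖α‖ ≤ M) (hβ : ‖β‖ ≤ M) (N : ℕ) :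
    ‖α ^ N - β ^ N‖ ≤ N * ‖α - β‖ * M ^ N := by
  induction N with
  | zero => simp
  | succ N ih =>
    have h : α ^ (N + 1) - β ^ (N + 1) = α * (α ^ N - β ^ N) + (α - β) * β ^ N := by ring
    rw [h]
    have h1 : ‖β ^ N‖ ≤ M ^ N := by rw [norm_pow]; gcongr
    have h2 : M ^ N ≤ M ^ (N + 1) := pow_le_pow_right₀ hM (by omega)
    calc _ ≤ ‖α‖ * ‖α ^ N - β ^ N‖ + ‖α - β‖ * ‖β ^ N‖ := by
          rw [← norm_mul, ← norm_mul]; exact norm_add_le _ _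
      _ ≤ M * (N * ‖α - β‖ * M ^ N) + ‖α - β‖ * M ^ (N + 1) := by
          gcongr
          exact h1.trans h2
      _ = _ := by push_cast; ring

lemma one_add_mul_sq_pow_le_exp {p B K : ℝ} {N : ℕ} (hK : 0 ≤ K) (h : p ^ 2 * N ≤ B) :
    (1 + p ^ 2 * K) ^ N ≤ Real.exp (K * B) := by
  calc (1 + p ^ 2 * K) ^ N ≤ Real.exp (p ^ 2 * K) ^ N := by
        gcongr
        rw [add_comm]
        exact Real.add_one_le_exp _
    _ = Real.exp (K * (p ^ 2 * N)) := by rw [← Real.exp_nat_mul]; congr 1; ring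
    _ ≤ _ := by gcongr

/-- The bases differ by `p² ‖α - β‖`, and the power multiplies this by at most `N` and a bounded
factor; `p² N ≤ B` makes the estimate uniform in `N`. -/
lemma norm_one_add_sq_mul_pow_sub_le {p B K : ℝ} {N : ℕ} (h : p ^ 2 * N ≤ B) {α β : ℂ}
    (hα : ‖α‖ ≤ K) (hβ : ‖β‖ ≤ K) :
    ‖(1 + (p : ℂ) ^ 2 * α) ^ N - (1 + (p : ℂ) ^ 2 * β) ^ N‖ ≤
      B * Real.exp (K * B) * ‖α - β‖ := by
  have hK : 0 ≤ K := (norm_nonneg _).trans hα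
  have hn : ∀ z : ℂ, ‖z‖ ≤ K → ‖1 + (p : ℂ) ^ 2 * z‖ ≤ 1 + p ^ 2 * K := by
    intro z hz
    refine (norm_add_le _ _).trans ?_
    rw [norm_one, norm_mul, norm_pow, Complex.norm_real, Real.norm_eq_abs, sq_abs]
    gcongr
  refine (norm_pow_sub_pow_le (by nlinarith [sq_nonneg p]) (hn α hα) (hn β hβ) N).trans ?_
  have h1 : ‖1 + (p : ℂ) ^ 2 * α - (1 + (p : ℂ) ^ 2 * β)‖ = p ^ 2 * ‖α - β‖ := by
    rw [add_sub_add_left_eq_sub, ← mul_sub, norm_mul, norm_pow, Complex.norm_real,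
      Real.norm_eq_abs, sq_abs]
  rw [h1]
  calc _ = (p ^ 2 * N) * (1 + p ^ 2 * K) ^ N * ‖α - β‖ := by ring
    _ ≤ _ := by
      have := one_add_mul_sq_pow_le_exp hK h
      have hB : 0 ≤ B := le_trans (by positivity) h
      gcongr

variable {X : Type*} [MeasurableSpace X] {ν : Measure X} [IsProbabilityMeasure ν]

lemma integral_norm_le_sqrt {f : X → ℂ} (hf : MemLp f 2 ν) :
    ∫ x, ‖f x‖ ∂ν ≤ √(∫ x, ‖f x‖ ^ 2 ∂ν) := by
  have h := variance_nonneg (fun x => ‖f x‖) ν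
  rw [variance_eq_sub hf.norm] at h
  refine Real.le_sqrt_of_sq_le ?_
  simpa using h

lemma integral_norm_sub_le_add_add {μ : Measure X} {a b c d : X → ℂ} (ha : Integrable a μ)
    (hb : Integrable b μ) (hc : Integrable c μ) (hd : Integrable d μ) :
    ∫ x, ‖a x - d x‖ ∂μ ≤ ∫ x, ‖a x - b x‖ ∂μ + ∫ x, ‖b x - c x‖ ∂μ + ∫ x, ‖d x - c x‖ ∂μ := by
  have i1 : Integrable (fun x => ‖a x - b x‖) μ := (ha.sub hb).norm
  have i2 : Integrable (fun x => ‖b x - c x‖) μ := (hb.sub hc).norm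
  have i3 : Integrable (fun x => ‖d x - c x‖) μ := (hd.sub hc).norm
  have i12 : Integrable (fun x => ‖a x - b x‖ + ‖b x - c x‖) μ := i1.add i2
  rw [← integral_add i1 i2, ← integral_add i12 i3]
  refine integral_mono (ha.sub hd).norm (i12.add i3) fun x => ?_
  rw [norm_sub_rev (d x)]
  refine le_trans (le_of_eq ?_) (norm_add₃_le)
  congr 1
  ring

lemma memLp_one_add_mul {g : X → ℂ} (hg : MemLp g 2 ν) (p : ℂ) :
    MemLp (fun y => 1 + p * (g y - 1)) 2 ν := by
  have h1 : MemLp (fun y => g y - 1) 2 ν := hg.sub (memLp_const (1 : ℂ))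
  have h2 : MemLp (fun y => p * (g y - 1)) 2 ν := h1.const_mul p
  exact (memLp_const (1 : ℂ)).add h2

/-- Mean one cancels the terms linear in `p`, leaving a correction of order `p²`. -/
lemma integral_one_add_mul_conj {g h : X → ℂ} (hg : MemLp g 2 ν) (hh : MemLp h 2 ν)
    (hg1 : ∫ y, g y ∂ν = 1) (hh1 : ∫ y, h y ∂ν = 1) (p : ℝ) :
    ∫ y, (1 + (p : ℂ) * (g y - 1)) * conj (1 + (p : ℂ) * (h y - 1)) ∂ν =
      1 + (p : ℂ) ^ 2 * (∫ y, g y * conj (h y) ∂ν - 1) := by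
  have ig : Integrable g ν := hg.integrable (by norm_num)
  have ih : Integrable (fun y => conj (h y)) ν := hh.star.integrable (by norm_num)
  have igh := integrable_mul_conj hg hh
  have hh2 : ∫ y, conj (h y) ∂ν = 1 := by rw [integral_conj, hh1, map_one]
  have : ∀ y, (1 + (p : ℂ) * (g y - 1)) * conj (1 + (p : ℂ) * (h y - 1)) =
      (1 - (p : ℂ)) ^ 2 + ((p : ℂ) * (1 - p)) * g y + ((p : ℂ) * (1 - p)) * conj (h y) +
        (p : ℂ) ^ 2 * (g y * conj (h y)) := by
    intro y
    simp only [map_add, map_mul, map_sub, map_one, Complex.conj_ofReal]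
    ring
  simp_rw [this]
  rw [integral_add (by fun_prop) (by fun_prop), integral_add (by fun_prop) (by fun_prop),
    integral_add (by fun_prop) (by fun_prop), integral_const_mul, integral_const_mul,
    integral_const_mul, hg1, hh2]
  simp
  ring

variable {E : ℕ → Type*} [∀ n, Fintype (E n)] {S : ∀ n, Finset (Finset (E n))} {p : ℕ → ℝ}

lemma measurable_prod_eval {ι : Type*} {u : X → ℂ} (hu : Measurable u) (Γ : Finset ι) :
    Measurable fun x : ι → X => ∏ e ∈ Γ, u (x e) :=
  Finset.measurable_fun_prod _ fun e _ => hu.comp (measurable_pi_apply e)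

lemma memLp_avgProd {ι : Type*} [Fintype ι] (T : Finset (Finset ι)) {u : X → ℂ}
    (hm : Measurable u) (hu : MemLp u 2 ν) :
    MemLp (fun x : ι → X => avgProd T u x) 2 (Measure.pi fun _ => ν) := by
  simp only [avgProd, div_eq_mul_inv]
  exact (memLp_finsetSum _ fun Γ _ => memLp_prod hm hu Γ).mul_const _

lemma integrable_avgProd {ι : Type*} [Fintype ι] (T : Finset (Finset ι)) {u : X → ℂ}
    (hm : Measurable u) (hu : MemLp u 2 ν) :
    Integrable (fun x : ι → X => avgProd T u x) (Measure.pi fun _ => ν) :=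
  (memLp_avgProd T hm hu).integrable (by norm_num)

lemma integral_norm_sq_sub_one {g : X → ℂ} (hg : MemLp g 2 ν) (h1 : ∫ y, g y ∂ν = 1) :
    ∫ y, ‖g y - 1‖ ^ 2 ∂ν = ∫ y, ‖g y‖ ^ 2 ∂ν - 1 := by
  have h : ∀ y, ‖g y - 1‖ ^ 2 = ‖g y‖ ^ 2 + 1 - 2 * (g y).re := by
    intro y
    rw [← Complex.normSq_eq_norm_sq, ← Complex.normSq_eq_norm_sq, Complex.normSq_sub]
    simp
  have hi : Integrable g ν := hg.integrable (by norm_num)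
  have i2 : Integrable (fun y => ‖g y‖ ^ 2) ν := (memLp_two_iff_integrable_sq_norm hg.1).1 hg
  have ire : Integrable (fun y => 2 * (g y).re) ν := hi.re.const_mul 2
  have hre : ∫ y, (g y).re ∂ν = 1 := by
    have := integral_re hi
    simp only [RCLike.re_eq_complex_re] at this
    rw [this, h1, Complex.one_re]
  simp_rw [h]
  rw [integral_sub (f := fun y => ‖g y‖ ^ 2 + 1) (i2.add (integrable_const 1)) ire,
    integral_add i2 (integrable_const 1),
    integral_const_mul, hre]
  simp
  ring

/-- The average of products is close, in `L¹`, to the product with independent edges. -/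
lemma IsAlmostIndependent.tendsto_avgProd_sub (hS : IsAlmostIndependent S p) {g : ℕ → X → ℂ}
    (hgm : ∀ n, Measurable (g n)) (hg : ∀ n, MemLp (g n) 2 ν)
    (h1 : ∀ᶠ n in atTop, ∫ y, g n y ∂ν = 1) {A : ℝ}
    (hA : ∀ᶠ n in atTop, ∫ y, ‖g n y‖ ^ 2 ∂ν ≤ A) :
    Tendsto (fun n => ∫ x : E n → X,
      ‖avgProd (S n) (g n) x - ∏ e, (1 + (p n : ℂ) * (g n (x e) - 1))‖ ∂(Measure.pi fun _ => ν))
      atTop (𝓝 0) := by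
  -- The absolute value only supplies the sign condition of `tendsto_sum`.
  have key := (hS.tendsto_sum |A| (abs_nonneg A)).sqrt
  rw [Real.sqrt_zero] at key
  refine squeeze_zero' (.of_forall fun n => integral_nonneg fun _ => norm_nonneg _) ?_ key
  filter_upwards [h1, hA] with n h1 hA
  refine (integral_norm_le_sqrt ((memLp_avgProd (S n) (hgm n) (hg n)).sub
    (memLp_prod (u := fun y => 1 + (p n : ℂ) * (g n y - 1)) (by have := hgm n; fun_prop)
      (memLp_one_add_mul (hg n) _) Finset.univ))).trans ?_
  refine Real.sqrt_le_sqrt ?_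
  refine (integral_norm_sq_avgProd_sub (S n) (hg n) h1 (p n)).le.trans ?_
  refine Finset.sum_le_sum fun Γ _ => ?_
  have h0 : 0 ≤ ∫ y, ‖g n y - 1‖ ^ 2 ∂ν := integral_nonneg fun _ => by positivity
  have h2 : ∫ y, ‖g n y - 1‖ ^ 2 ∂ν ≤ |A| := by
    rw [integral_norm_sq_sub_one (hg n) h1]
    linarith [le_abs_self A]
  gcongr

/-- By independence the squared `L²` distance is `x^N - 2 Re y^N + z^N`, each base being `1 + p²`
times a scalar. The three scalars have the common limit `C - 1`, so the powers cancel in the limit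
although `x^N` itself need not converge. -/
lemma IsAlmostIndependent.tendsto_prod_sub_prod (hS : IsAlmostIndependent S p) {g : ℕ → X → ℂ}
    {h : X → ℂ} (hgm : ∀ n, Measurable (g n)) (hhm : Measurable h)
    (hg : ∀ n, MemLp (g n) 2 ν) (hh : MemLp h 2 ν)
    (hg1 : ∀ᶠ n in atTop, ∫ y, g n y ∂ν = 1) (hh1 : ∫ y, h y ∂ν = 1)
    (hgg : Tendsto (fun n => ∫ y, ‖g n y‖ ^ 2 ∂ν) atTop (𝓝 (∫ y, ‖h y‖ ^ 2 ∂ν)))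
    (hgh : Tendsto (fun n => ∫ y, g n y * conj (h y) ∂ν) atTop
      (𝓝 ((∫ y, ‖h y‖ ^ 2 ∂ν : ℝ) : ℂ))) :
    Tendsto (fun n => ∫ x : E n → X,
      ‖∏ e, (1 + (p n : ℂ) * (g n (x e) - 1)) - ∏ e, (1 + (p n : ℂ) * (h (x e) - 1))‖
        ∂(Measure.pi fun _ => ν)) atTop (𝓝 0) := by
  obtain ⟨B, hB, hpB⟩ := hS.exists_bound
  set C : ℝ := ∫ y, ‖h y‖ ^ 2 ∂ν with hC
  have hggC : Tendsto (fun n => ((∫ y, ‖g n y‖ ^ 2 ∂ν : ℝ) : ℂ) - 1) atTop (𝓝 ((C : ℂ) - 1)) :=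
    ((Complex.continuous_ofReal.tendsto C).comp hgg).sub_const 1
  have hghC : Tendsto (fun n => ∫ y, g n y * conj (h y) ∂ν - 1) atTop (𝓝 ((C : ℂ) - 1)) :=
    hgh.sub_const 1
  set K : ℝ := ‖(C : ℂ) - 1‖ + 1
  have hlim : Tendsto (fun n => √(B * Real.exp (K * B) *
      ‖(((∫ y, ‖g n y‖ ^ 2 ∂ν : ℝ) : ℂ) - 1) - ((C : ℂ) - 1)‖ +
      2 * (B * Real.exp (K * B) * ‖(∫ y, g n y * conj (h y) ∂ν - 1) - ((C : ℂ) - 1)‖)))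
      atTop (𝓝 0) := by
    have h1 := ((hggC.sub_const ((C : ℂ) - 1)).norm.const_mul (B * Real.exp (K * B))).add
      (((hghC.sub_const ((C : ℂ) - 1)).norm.const_mul (B * Real.exp (K * B))).const_mul 2)
    simpa using h1.sqrt
  refine squeeze_zero' (.of_forall fun n => integral_nonneg fun _ => norm_nonneg _) ?_ hlim
  filter_upwards [hg1, hpB, hggC.norm.eventually_lt_const (lt_add_one _),
    hghC.norm.eventually_lt_const (lt_add_one _)] with n h1 h2 h3 h4
  have mu := memLp_one_add_mul (hg n) (p n)
  have mv := memLp_one_add_mul hh (p n)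
  refine (integral_norm_le_sqrt ((memLp_prod (by have := hgm n; fun_prop) mu Finset.univ).sub
    (memLp_prod (by fun_prop) mv Finset.univ))).trans ?_
  refine Real.sqrt_le_sqrt ?_
  refine (integral_norm_sq_prod_sub_prod (E := E n) mu mv).le.trans ?_
  have e1 : ((∫ y, ‖1 + (p n : ℂ) * (g n y - 1)‖ ^ 2 ∂ν : ℝ) : ℂ) =
      1 + (p n : ℂ) ^ 2 * (((∫ y, ‖g n y‖ ^ 2 ∂ν : ℝ) : ℂ) - 1) := by
    rw [← integral_normSq_complex, integral_one_add_mul_conj (hg n) (hg n) h1 h1,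
      integral_normSq_complex]
  have e2 : ((∫ y, ‖1 + (p n : ℂ) * (h y - 1)‖ ^ 2 ∂ν : ℝ) : ℂ) =
      1 + (p n : ℂ) ^ 2 * ((C : ℂ) - 1) := by
    rw [← integral_normSq_complex, integral_one_add_mul_conj hh hh hh1 hh1,
      integral_normSq_complex]
  rw [integral_one_add_mul_conj (hg n) hh h1 hh1]
  have d1 := norm_one_add_sq_mul_pow_sub_le h2 h3.le (lt_add_one ‖(C : ℂ) - 1‖).le
  have d2 := norm_one_add_sq_mul_pow_sub_le h2 h4.le (lt_add_one ‖(C : ℂ) - 1‖).le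
  rw [← e1, ← e2] at d1
  rw [← e2] at d2
  rw [← Complex.ofReal_pow, ← Complex.ofReal_pow, ← Complex.ofReal_sub, Complex.norm_real,
    Real.norm_eq_abs] at d1
  have d3 := (Complex.abs_re_le_norm _).trans d2
  rw [Complex.sub_re, ← Complex.ofReal_pow _ (Fintype.card (E n)), Complex.ofReal_re] at d3
  have := (abs_le.1 d1).2
  have := (abs_le.1 d3).1
  linarith

/-- Averages of products along the configurations of two nearby functions are close in `L¹`. -/
lemma IsAlmostIndependent.tendsto_avgProd_sub_avgProd (hS : IsAlmostIndependent S p)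
    {g : ℕ → X → ℂ} {h : X → ℂ} (hgm : ∀ n, Measurable (g n)) (hhm : Measurable h)
    (hg : ∀ n, MemLp (g n) 2 ν) (hh : MemLp h 2 ν)
    (hg1 : ∀ᶠ n in atTop, ∫ y, g n y ∂ν = 1) (hh1 : ∫ y, h y ∂ν = 1)
    (hgg : Tendsto (fun n => ∫ y, ‖g n y‖ ^ 2 ∂ν) atTop (𝓝 (∫ y, ‖h y‖ ^ 2 ∂ν)))
    (hgh : Tendsto (fun n => ∫ y, g n y * conj (h y) ∂ν) atTop
      (𝓝 ((∫ y, ‖h y‖ ^ 2 ∂ν : ℝ) : ℂ))) :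
    Tendsto (fun n => ∫ x : E n → X, ‖avgProd (S n) (g n) x - avgProd (S n) h x‖
        ∂(Measure.pi fun _ => ν)) atTop (𝓝 0) := by
  have l1 := hS.tendsto_avgProd_sub hgm hg hg1 (hgg.eventually_le_const (lt_add_one _))
  have l2 := hS.tendsto_prod_sub_prod hgm hhm hg hh hg1 hh1 hgg hgh
  have l3 := hS.tendsto_avgProd_sub (fun _ => hhm) (fun _ => hh) (.of_forall fun _ => hh1)
    (.of_forall fun _ => le_rfl)
  have hlim := (l1.add l2).add l3
  simp only [add_zero] at hlim
  refine squeeze_zero (fun n => integral_nonneg fun _ => norm_nonneg _) (fun n => ?_) hlim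
  have iu : ∀ u : X → ℂ, Measurable u → MemLp u 2 ν → Integrable (fun x : E n → X =>
      ∏ e, (1 + (p n : ℂ) * (u (x e) - 1))) (Measure.pi fun _ => ν) := fun u hu hu2 =>
    (memLp_prod (u := fun y => 1 + (p n : ℂ) * (u y - 1)) (by fun_prop)
      (memLp_one_add_mul hu2 _) Finset.univ).integrable (by norm_num)
  have i1 := integrable_avgProd (S n) (hgm n) (hg n)
  have i2 := integrable_avgProd (S n) hhm hh
  have j1 := iu _ (hgm n) (hg n)
  have j2 := iu _ hhm hh
  exact integral_norm_sub_le_add_add i1 j1 j2 i2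

end Comparison

/-! ### Weak convergence of the Gibbs measures -/

/-- Lévy's continuity theorem for measures of varying mass at most `1`. -/
lemma tendsto_integral_sub_of_tendsto_charFun {M : ℕ → Measure ℝ} [∀ n, IsFiniteMeasure (M n)]
    (hM : ∀ n, (M n).real Set.univ ≤ 1) {μ : Measure ℝ} [IsProbabilityMeasure μ]
    (h : ∀ t, Tendsto (fun n => charFun (M n) t - (M n).real Set.univ * charFun μ t) atTop (𝓝 0))
    (f : ℝ →ᵇ ℝ) :
    Tendsto (fun n => ∫ y, f y ∂(M n) - (M n).real Set.univ * ∫ y, f y ∂μ) atTop (𝓝 0) := by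
  -- Adding the missing mass as a multiple of `μ` yields probability measures, for which the
  -- hypothesis `h` is exactly convergence of characteristic functions to that of `μ`.
  set c : ℕ → ℝ := fun n => 1 - (M n).real Set.univ with hc
  have hc0 : ∀ n, 0 ≤ c n := fun n => sub_nonneg.2 (hM n)
  let N : ℕ → Measure ℝ := fun n => M n + ENNReal.ofReal (c n) • μ
  have hfin : ∀ n, IsFiniteMeasure (ENNReal.ofReal (c n) • μ) := fun n =>
    μ.smul_finite ENNReal.ofReal_ne_top
  have hN : ∀ n, IsProbabilityMeasure (N n) := by
    intro n
    refine ⟨?_⟩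
    simp only [N, Measure.coe_add, Measure.coe_smul, Pi.add_apply, Pi.smul_apply, measure_univ,
      smul_eq_mul, mul_one, hc]
    rw [← ofReal_measureReal (measure_ne_top _ _), ← ENNReal.ofReal_add measureReal_nonneg (hc0 n)]
    simp [hc]
  have hint : ∀ {F : Type} [NormedAddCommGroup F] [NormedSpace ℝ F] (g : ℝ → F) (C : ℝ),
      Continuous g → (∀ y, ‖g y‖ ≤ C) → ∀ n,
      ∫ y, g y ∂(N n) = ∫ y, g y ∂(M n) + c n • ∫ y, g y ∂μ := by
    intro F _ _ g C hg hgC n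
    rw [integral_add_measure, integral_smul_measure, ENNReal.toReal_ofReal (hc0 n)]
    · exact .of_bound hg.aestronglyMeasurable C (.of_forall hgC)
    · exact .of_bound hg.aestronglyMeasurable C (.of_forall hgC)
  let PN : ℕ → ProbabilityMeasure ℝ := fun n => ⟨N n, hN n⟩
  let P0 : ProbabilityMeasure ℝ := ⟨μ, inferInstance⟩
  have key : Tendsto PN atTop (𝓝 P0) := by
    refine ProbabilityMeasure.tendsto_of_tendsto_charFun fun t => ?_
    rw [← tendsto_sub_nhds_zero_iff]
    refine (h t).congr fun n => ?_
    change _ = charFun (N n) t - charFun μ t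
    simp only [charFun_apply_real]
    rw [hint (fun y : ℝ => Complex.exp (t * y * Complex.I)) 1 (by fun_prop)
      (fun y => by rw [← Complex.ofReal_mul, Complex.norm_exp_ofReal_mul_I])]
    simp only [hc, Complex.real_smul]
    push_cast
    ring
  rw [ProbabilityMeasure.tendsto_iff_forall_integral_tendsto] at key
  have h2 := tendsto_sub_nhds_zero_iff.2 (key f)
  refine h2.congr fun n => ?_
  change ∫ y, f y ∂(N n) - ∫ y, f y ∂μ = _
  rw [hint f ‖f‖ f.continuous f.norm_coe_le_norm]
  simp only [hc, smul_eq_mul]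
  ring

/-! ### Annealed laws of the rescaled sum on an event. -/

section Gibbs

variable {X : Type*} [MeasurableSpace X] {ν : Measure X} [IsProbabilityMeasure ν]

/-- The uniform average over `S` of the products of `a` along `π` times `g` at the rescaled sum
of `u` along `π`. -/
def tiltedAvg {ι F : Type*} [NormedAddCommGroup F] [NormedSpace ℝ F] (S : Finset (Finset ι))
    (a u : X → ℝ) (s : ℝ) (g : ℝ → F) (x : ι → X) : F :=
  ∑ π ∈ S, ((∏ e ∈ π, a (x e)) / (S.card : ℝ)) • g ((∑ e ∈ π, u (x e)) / s)

/-- The annealed law of the rescaled sum on an event `A`. -/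
def annealedLaw {ι : Type*} [Fintype ι] (ν : Measure X) (S : Finset (Finset ι))
    (a u : X → ℝ) (s : ℝ) (A : Set (ι → X)) : Measure ℝ :=
  ∑ π ∈ S, (((Measure.pi fun _ : ι => ν).restrict A).withDensity
    fun x => ENNReal.ofReal ((∏ e ∈ π, a (x e)) / (S.card : ℝ))).map
      fun x => (∑ e ∈ π, u (x e)) / s

section Single

variable {ι : Type*} (S : Finset (Finset ι)) {a u : X → ℝ} (s : ℝ)
  (A : Set (ι → X))


lemma measurable_prod_real (ha : Measurable a) (π : Finset ι) :
    Measurable fun x : ι → X => (∏ e ∈ π, a (x e)) / (S.card : ℝ) :=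
  (Finset.measurable_fun_prod _ fun e _ => ha.comp (measurable_pi_apply e)).div_const _

lemma measurable_sum_real (hu : Measurable u) (π : Finset ι) :
    Measurable fun x : ι → X => (∑ e ∈ π, u (x e)) / s :=
  (Finset.measurable_fun_sum _ fun e _ => hu.comp (measurable_pi_apply e)).div_const _

variable [Fintype ι]

lemma integrable_prod_real (hai : Integrable a ν) (π : Finset ι) :
    Integrable (fun x : ι → X => (∏ e ∈ π, a (x e)) / (S.card : ℝ)) (Measure.pi fun _ => ν) := by
  classical
  refine Integrable.div_const ?_ _
  have : ∀ x : ι → X, ∏ e ∈ π, a (x e) = ∏ e, (fun e y => if e ∈ π then a y else 1) e (x e) := by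
    intro x; simp
  simp_rw [this]
  refine Integrable.fintype_prod (μ := fun _ : ι => ν) (f := fun e y => if e ∈ π then a y else 1)
    fun e => ?_
  by_cases h : e ∈ π <;> simp [h, hai]

lemma integral_prod_real (h1 : ∫ y, a y ∂ν = 1) (π : Finset ι) :
    ∫ x : ι → X, ∏ e ∈ π, a (x e) ∂(Measure.pi fun _ => ν) = 1 := by
  classical
  have : ∀ x : ι → X, ∏ e ∈ π, a (x e) = ∏ e, (fun e y => if e ∈ π then a y else 1) e (x e) := by
    intro x; simp
  simp_rw [this]
  rw [integral_fintype_prod_eq_prod (μ := fun _ : ι => ν) fun e y => if e ∈ π then a y else 1]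
  refine Finset.prod_eq_one fun e _ => ?_
  by_cases h : e ∈ π <;> simp [h, h1]

lemma isFiniteMeasure_withDensity_prod (hai : Integrable a ν) (π : Finset ι) :
    IsFiniteMeasure (((Measure.pi fun _ : ι => ν).restrict A).withDensity
      fun x => ENNReal.ofReal ((∏ e ∈ π, a (x e)) / (S.card : ℝ))) :=
  isFiniteMeasure_withDensity_ofReal (integrable_prod_real S hai π).restrict.2

lemma isFiniteMeasure_annealedLaw (hai : Integrable a ν) :
    IsFiniteMeasure (annealedLaw ν S a u s A) := by
  have := isFiniteMeasure_withDensity_prod S A hai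
  unfold annealedLaw
  infer_instance

variable {F : Type*} [NormedAddCommGroup F] [NormedSpace ℝ F] [SecondCountableTopology F]
  {g : ℝ → F} {C : ℝ}

lemma integrable_prod_smul (hu : Measurable u) (hai : Integrable a ν)
    (hg : Continuous g) (hC : ∀ y, ‖g y‖ ≤ C) (π : Finset ι) :
    Integrable (fun x : ι → X => ((∏ e ∈ π, a (x e)) / (S.card : ℝ)) •
      g ((∑ e ∈ π, u (x e)) / s)) (Measure.pi fun _ => ν) :=
  (integrable_prod_real S hai π).smul_bdd C
    (hg.aestronglyMeasurable.comp_measurable (measurable_sum_real s hu π))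
    (.of_forall fun _ => hC _)

lemma integrable_tiltedAvg (hu : Measurable u) (hai : Integrable a ν)
    (hg : Continuous g) (hC : ∀ y, ‖g y‖ ≤ C) :
    Integrable (tiltedAvg S a u s g : (ι → X) → F) (Measure.pi fun _ => ν) :=
  integrable_finsetSum _ fun π _ => integrable_prod_smul S s hu hai hg hC π

lemma integral_annealedLaw (ha : Measurable a) (ha0 : ∀ y, 0 ≤ a y) (hu : Measurable u)
    (hai : Integrable a ν) (hg : Continuous g) (hC : ∀ y, ‖g y‖ ≤ C) :
    ∫ y, g y ∂(annealedLaw ν S a u s A) =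
      ∫ x in A, tiltedAvg S a u s g x ∂(Measure.pi fun _ => ν) := by
  have hf := isFiniteMeasure_withDensity_prod S A hai
  unfold annealedLaw tiltedAvg
  rw [integral_finsetSum_measure fun π _ =>
      .of_bound hg.aestronglyMeasurable C (.of_forall hC),
    integral_finsetSum _ fun π _ => (integrable_prod_smul S s hu hai hg hC π).integrableOn]
  refine Finset.sum_congr rfl fun π _ => ?_
  rw [integral_map (measurable_sum_real s hu π).aemeasurable hg.aestronglyMeasurable,
    integral_withDensity_eq_integral_toReal_smul
      (measurable_prod_real S ha π).ennreal_ofReal (.of_forall fun _ => ENNReal.ofReal_lt_top)]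
  refine integral_congr_ae (.of_forall fun x => ?_)
  simp only
  rw [ENNReal.toReal_ofReal]
  exact div_nonneg (Finset.prod_nonneg fun e _ => ha0 _) (by positivity)

end Single

end Gibbs

/-! ### Lower bound for the partition function and limit of the Gibbs averages. -/

section GibbsLimit

open scoped ComplexConjugate

variable {X : Type*} [MeasurableSpace X] {ν : Measure X} {a u : X → ℝ}

/-- The uniform average over `S` of the products of `a` along the configurations. -/
def partitionAvg {ι X : Type*} (S : Finset (Finset ι)) (a : X → ℝ) (x : ι → X) : ℝ :=
  ∑ π ∈ S, (∏ e ∈ π, a (x e)) / (S.card : ℝ)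

lemma ofReal_partitionAvg {ι X : Type*} (S : Finset (Finset ι)) (a : X → ℝ) (x : ι → X) :
    (partitionAvg S a x : ℂ) = avgProd S (fun y => (a y : ℂ)) x := by
  simp [partitionAvg, avgProd, Finset.sum_div]

lemma tiltedAvg_one {ι X : Type*} (S : Finset (Finset ι)) (a u : X → ℝ) (s : ℝ) :
    (tiltedAvg S a u s (fun _ => (1 : ℝ)) : (ι → X) → ℝ) = partitionAvg S a := by
  ext x
  simp [tiltedAvg, partitionAvg]

/-- The exponential of a sum factorizes along `π`, so characteristic functions fall under the
polynomial estimates. -/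
lemma tiltedAvg_exp {ι X : Type*} (S : Finset (Finset ι)) (a u : X → ℝ) (s t : ℝ) (x : ι → X) :
    tiltedAvg S a u s (fun y : ℝ => Complex.exp (t * y * Complex.I)) x =
      avgProd S (fun y => a y • Complex.exp ((t * u y / s : ℝ) * Complex.I)) x := by
  rw [tiltedAvg, avgProd, Finset.sum_div]
  refine Finset.sum_congr rfl fun π _ => ?_
  simp only [Complex.real_smul]
  rw [Finset.prod_mul_distrib, ← Complex.exp_sum, ← Finset.sum_mul, ← Complex.ofReal_mul,
    ← Complex.ofReal_sum, mul_div_right_comm]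
  congr 3
  · push_cast; rfl
  · rw [mul_div_assoc', Finset.mul_sum, Finset.sum_div]

lemma partitionAvg_nonneg {ι X : Type*} (S : Finset (Finset ι)) {a : X → ℝ} (ha0 : ∀ y, 0 ≤ a y)
    (x : ι → X) : 0 ≤ partitionAvg S a x :=
  Finset.sum_nonneg fun _ _ => div_nonneg (Finset.prod_nonneg fun _ _ => ha0 _) (by positivity)

lemma measurable_partitionAvg {ι : Type*} (S : Finset (Finset ι)) (ha : Measurable a) :
    Measurable (partitionAvg S a : (ι → X) → ℝ) :=
  Finset.measurable_fun_sum _ fun π _ => measurable_prod_real S ha π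

lemma measurable_tiltedAvg {ι : Type*} (S : Finset (Finset ι)) (ha : Measurable a)
    (hu : Measurable u) (s : ℝ) {g : ℝ → ℝ} (hg : Continuous g) :
    Measurable (tiltedAvg S a u s g : (ι → X) → ℝ) :=
  Finset.measurable_fun_sum _ fun π _ =>
    (measurable_prod_real S ha π).smul (hg.measurable.comp (measurable_sum_real s hu π))

variable [IsProbabilityMeasure ν]

lemma integrable_partitionAvg {ι : Type*} [Fintype ι] (S : Finset (Finset ι))
    (hai : Integrable a ν) :
    Integrable (partitionAvg S a : (ι → X) → ℝ) (Measure.pi fun _ => ν) :=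
  integrable_finsetSum _ fun π _ => integrable_prod_real S hai π

/-- Each product has mean one; equality fails only for empty `S`, where the average is `0`. -/
lemma integral_partitionAvg_le {ι : Type*} [Fintype ι] (S : Finset (Finset ι))
    (hai : Integrable a ν) (h1 : ∫ y, a y ∂ν = 1) :
    ∫ x : ι → X, partitionAvg S a x ∂(Measure.pi fun _ => ν) ≤ 1 := by
  unfold partitionAvg
  rw [integral_finsetSum _ fun π _ => integrable_prod_real S hai π]
  simp_rw [integral_div, integral_prod_real h1]
  simp [mul_inv_le_one]

lemma real_univ_annealedLaw {ι : Type*} [Fintype ι] (S : Finset (Finset ι)) (s : ℝ)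
    (A : Set (ι → X)) (ha : Measurable a) (ha0 : ∀ y, 0 ≤ a y) (hu : Measurable u)
    (hai : Integrable a ν) :
    (annealedLaw ν S a u s A).real Set.univ =
      ∫ x in A, partitionAvg S a x ∂(Measure.pi fun _ => ν) := by
  have := integral_annealedLaw S s A ha ha0 hu hai (g := fun _ => (1 : ℝ)) (C := 1)
    continuous_const (by simp)
  rw [tiltedAvg_one] at this
  simpa using this

variable {E : ℕ → Type*} [∀ n, Fintype (E n)] {S : ∀ n, Finset (Finset (E n))} {p : ℕ → ℝ}

/-- The normalised partition function is bounded away from `0` in probability. -/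
lemma IsAlmostIndependent.exists_measure_partitionAvg_lt (hS : IsAlmostIndependent S p)
    (ha : Measurable a) (ha0 : ∀ y, 0 ≤ a y) (h2 : MemLp a 2 ν) (h1 : ∫ y, a y ∂ν = 1) :
    ∃ C : ℝ, 0 < C ∧ ∀ η : ℝ, 0 < η → ∀ᶠ n in atTop,
      (Measure.pi fun _ : E n => ν).real {x | partitionAvg (S n) a x < η} ≤ C * η := by
  obtain ⟨B, hB, hpB⟩ := hS.exists_bound
  have hai : Integrable a ν := h2.integrable (by norm_num)
  have hm : Measurable fun y => (a y : ℂ) := by fun_prop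
  have h2c : MemLp (fun y => (a y : ℂ)) 2 ν := h2.ofReal
  have h1c : ∫ y, (a y : ℂ) ∂ν = 1 := by rw [integral_complex_ofReal, h1]; rfl
  set σ : ℝ := ∫ y, (a y - 1) ^ 2 ∂ν with hσ
  have hσ0 : 0 ≤ σ := integral_nonneg fun _ => sq_nonneg _
  refine ⟨2 * Real.exp (2 * σ * B) + 1, by positivity, fun η hη => ?_⟩
  have hL1 := hS.tendsto_avgProd_sub (fun _ => hm) (fun _ => h2c) (.of_forall fun _ => h1c)
    (.of_forall fun _ => le_rfl)
  filter_upwards [hpB, hL1.eventually_le_const (show 0 < η ^ 2 by positivity),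
    hS.tendsto_zero.eventually_le_const (show (0 : ℝ) < 1 / 2 by norm_num)] with n hB hL hp
  have hp0 := hS.nonneg n
  set q := p n
  set Q := Measure.pi fun _ : E n => ν
  -- As `q ≤ 1/2` and `a ≥ 0`, the factors of `D` stay away from zero and their inverses are
  -- bounded.
  have hf : ∀ y, 1 / 2 ≤ 1 + q * (a y - 1) := fun y => by nlinarith [ha0 y]
  set D : (E n → X) → ℝ := fun x => ∏ e, (1 + q * (a (x e) - 1)) with hD
  have hDpos : ∀ x, 0 < D x := fun x => Finset.prod_pos fun e _ => by linarith [hf (x e)]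
  have hasub : Integrable (fun y => a y - 1) ν := hai.sub (integrable_const _)
  have hasq : Integrable (fun y => (a y - 1) ^ 2) ν :=
    MemLp.integrable_sq (f := fun y => a y - 1) (h2.sub (memLp_const (1 : ℝ)))
  have hinv : Integrable (fun y => (1 + q * (a y - 1))⁻¹) ν := by
    refine .of_bound (by fun_prop) 2 (.of_forall fun y => ?_)
    rw [Real.norm_of_nonneg (inv_nonneg.2 (by linarith [hf y]))]
    exact inv_le_of_inv_le₀ two_pos (by linarith [hf y])
  have hDinv : ∫ x, (D x)⁻¹ ∂Q ≤ Real.exp (2 * σ * B) := by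
    simp only [hD, ← Finset.prod_inv_distrib]
    rw [integral_fintype_prod_eq_pow fun y => (1 + q * (a y - 1))⁻¹]
    refine le_trans ?_ (one_add_mul_sq_pow_le_exp (by positivity) hB)
    refine pow_le_pow_left₀ (integral_nonneg fun y => inv_nonneg.2 (by linarith [hf y])) ?_ _
    -- This is `1/(1+z) ≤ 1 - z + 2z²` for `z ≥ -1/2`. The linear term integrates to zero, so each
    -- factor has inverse moment at most `1 + 2σq²`.
    have hb : ∀ y, (1 + q * (a y - 1))⁻¹ ≤ 1 - q * (a y - 1) + 2 * q ^ 2 * (a y - 1) ^ 2 := by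
      intro y
      rw [inv_le_iff_one_le_mul₀ (by linarith [hf y])]
      have := hf y
      nlinarith [mul_nonneg (sq_nonneg (q * (a y - 1)))
        (show 0 ≤ 1 + 2 * (q * (a y - 1)) by linarith)]
    have j1 : Integrable (fun y => 1 - q * (a y - 1)) ν :=
      (integrable_const _).sub (hasub.const_mul q)
    have j2 : Integrable (fun y => 2 * q ^ 2 * (a y - 1) ^ 2) ν := hasq.const_mul _
    refine (integral_mono hinv (j1.add j2) hb).trans (le_of_eq ?_)
    simp only [Pi.add_apply]
    rw [integral_add j1 j2, integral_sub (integrable_const _) (hasub.const_mul q),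
      integral_const_mul, integral_const_mul, integral_sub hai (integrable_const _), h1]
    simp
    ring
  have hDi : Integrable (fun x => (D x)⁻¹) Q := by
    simp only [hD, ← Finset.prod_inv_distrib]
    exact Integrable.fintype_prod (μ := fun _ : E n => ν)
      (f := fun _ y => (1 + q * (a y - 1))⁻¹) fun _ => hinv
  have hZD : Integrable (fun x => |partitionAvg (S n) a x - D x|) Q := by
    refine ((integrable_partitionAvg (S n) hai).sub ?_).abs
    exact Integrable.fintype_prod (μ := fun _ : E n => ν)
      (f := fun _ y => 1 + q * (a y - 1)) fun _ => (integrable_const _).add (hasub.const_mul q)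
  have hL' : ∫ x, |partitionAvg (S n) a x - D x| ∂Q ≤ η ^ 2 := by
    refine le_trans (le_of_eq ?_) hL
    congr 1 with x
    rw [← ofReal_partitionAvg, ← Real.norm_eq_abs, ← Complex.norm_real]
    congr 1
    simp only [hD]
    push_cast
    rfl
  -- Markov's inequality handles both events: the first through the inverse moment of `D`, the
  -- second through the `L¹` distance, taken below `η²` so as to leave `η`.
  have hsub : {x | partitionAvg (S n) a x < η} ⊆
      {x | (2 * η)⁻¹ ≤ (D x)⁻¹} ∪ {x | η ≤ |partitionAvg (S n) a x - D x|} := by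
    intro x hx
    simp only [Set.mem_ofPred_eq, Set.mem_union] at hx ⊢
    by_cases h : D x ≤ 2 * η
    · exact Or.inl (inv_anti₀ (hDpos x) h)
    · right
      rw [abs_sub_comm]
      refine le_trans ?_ (le_abs_self _)
      linarith
  have m1 := mul_meas_ge_le_integral_of_nonneg (.of_forall fun x => (inv_pos.2 (hDpos x)).le) hDi
    (2 * η)⁻¹
  have m2 := mul_meas_ge_le_integral_of_nonneg (.of_forall fun x => abs_nonneg _) hZD η
  have m1' : Q.real {x | (2 * η)⁻¹ ≤ (D x)⁻¹} ≤ 2 * η * Real.exp (2 * σ * B) := by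
    rw [inv_mul_le_iff₀ (by positivity)] at m1
    exact m1.trans (by gcongr)
  have m2' : Q.real {x | η ≤ |partitionAvg (S n) a x - D x|} ≤ η := by
    have := m2.trans hL'
    rw [sq] at this
    exact le_of_mul_le_mul_left this hη
  calc _ ≤ _ := measureReal_mono hsub
    _ ≤ _ := measureReal_union_le _ _
    _ ≤ 2 * η * Real.exp (2 * σ * B) + η := add_le_add m1' m2'
    _ = _ := by ring

/-- Dominated convergence; needed for `b = a`, giving `κ → 1`, and for `b = a²`, giving convergence
of the scalar products with `a`. -/
lemma tendsto_integral_mul_exp {μ : Measure X} {b : X → ℝ} (hb : Measurable b) (hbi : Integrable b μ)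
    (hu : Measurable u) (t : ℝ) {s : ℕ → ℝ} (hs : Tendsto s atTop atTop) :
    Tendsto (fun n => ∫ y, b y • Complex.exp ((t * u y / s n : ℝ) * Complex.I) ∂μ) atTop
      (𝓝 ((∫ y, b y ∂μ : ℝ) : ℂ)) := by
  rw [← integral_complex_ofReal]
  refine tendsto_integral_of_dominated_convergence (fun y => ‖b y‖) (fun n => by fun_prop)
    hbi.norm (fun n => .of_forall fun y => ?_) (.of_forall fun y => ?_)
  · rw [norm_smul, Complex.norm_exp_ofReal_mul_I, mul_one]
  · have h1 : Tendsto (fun n => t * u y / s n) atTop (𝓝 0) := hs.const_div_atTop _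
    have h2 : Continuous fun z : ℝ => b y • Complex.exp ((z : ℂ) * Complex.I) := by fun_prop
    have := (h2.tendsto 0).comp h1
    simpa [Function.comp_def] using this

lemma avgProd_const_mul {ι X : Type*} {T : Finset (Finset ι)} {k : ℕ} (hT : ∀ π ∈ T, π.card = k)
    (c : ℂ) (g : X → ℂ) (x : ι → X) :
    avgProd T (fun y => c * g y) x = c ^ k * avgProd T g x := by
  rw [avgProd, avgProd, ← mul_div_assoc, Finset.mul_sum]
  congr 1
  refine Finset.sum_congr rfl fun π hπ => ?_
  rw [Finset.prod_mul_distrib, Finset.prod_const, hT π hπ]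

/-- The unnormalised characteristic functions of the Gibbs measures factorize asymptotically. -/
lemma IsAlmostIndependent.tendsto_tiltedAvg_exp_sub (hS : IsAlmostIndependent S p)
    {m : ℕ → ℕ} (hcard : ∀ᶠ n in atTop, ∀ π ∈ S n, π.card = m n) (hm : Tendsto m atTop atTop)
    (ha : Measurable a) (ha0 : ∀ y, 0 ≤ a y) (h2 : MemLp a 2 ν) (h1 : ∫ y, a y ∂ν = 1)
    (hu : Measurable u) {t : ℝ} {φ : ℂ}
    (hφ : Tendsto (fun n : ℕ => (∫ y, a y • Complex.exp ((t * u y / √n : ℝ) * Complex.I) ∂ν) ^ n)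
      atTop (𝓝 φ)) :
    Tendsto (fun n => ∫ x : E n → X,
      ‖tiltedAvg (S n) a u (√(m n)) (fun y : ℝ => Complex.exp (t * y * Complex.I)) x -
        φ * partitionAvg (S n) a x‖ ∂(Measure.pi fun _ => ν)) atTop (𝓝 0) := by
  have hai : Integrable a ν := h2.integrable (by norm_num)
  have hs : Tendsto (fun n => √(m n : ℝ)) atTop atTop :=
    Real.tendsto_sqrt_atTop.comp (tendsto_natCast_atTop_atTop.comp hm)
  set e : ℕ → X → ℂ := fun n y => Complex.exp ((t * u y / √(m n) : ℝ) * Complex.I) with he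
  have hen : ∀ n y, ‖e n y‖ = 1 := fun n y => Complex.norm_exp_ofReal_mul_I _
  have hem : ∀ n, Measurable (e n) := fun n => by simp only [he]; fun_prop
  set κ : ℕ → ℂ := fun n => ∫ y, a y • e n y ∂ν with hκ
  have hκm : Tendsto (fun n => κ n ^ m n) atTop (𝓝 φ) := hφ.comp hm
  have hκ1 : Tendsto κ atTop (𝓝 1) := by
    have := tendsto_integral_mul_exp ha hai hu t hs
    rwa [h1, Complex.ofReal_one] at this
  have hκn : ∀ n, ‖κ n‖ ≤ 1 := by
    intro n
    refine (norm_integral_le_integral_norm _).trans (le_of_eq ?_)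
    rw [← h1]
    congr 1 with y
    rw [norm_smul, hen, mul_one, Real.norm_of_nonneg (ha0 y)]
  have hκ0 : ∀ᶠ n in atTop, κ n ≠ 0 := hκ1.eventually_ne one_ne_zero
  -- Division by `κ n` restores mean one, as the comparison requires; the common size `m n` lets `κ
  -- n ^ m n` be pulled out of the average afterwards.
  set g : ℕ → X → ℂ := fun n y => (κ n)⁻¹ * (a y • e n y) with hg
  have hm2 : Measurable fun y => (a y : ℂ) := by fun_prop
  have h2c : MemLp (fun y => (a y : ℂ)) 2 ν := h2.ofReal
  have h1c : ∫ y, (a y : ℂ) ∂ν = 1 := by rw [integral_complex_ofReal, h1]; rfl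
  have haem : ∀ n, Measurable fun y => a y • e n y := fun n => by have := hem n; fun_prop
  have hae : ∀ n, MemLp (fun y => a y • e n y) 2 ν := fun n =>
    h2c.of_le (haem n).aestronglyMeasurable (.of_forall fun y => by
      rw [norm_smul, hen, mul_one, Complex.norm_real])
  have hg1 : ∀ᶠ n in atTop, ∫ y, g n y ∂ν = 1 := by
    filter_upwards [hκ0] with n hn
    simp only [hg]
    rw [integral_const_mul]
    exact inv_mul_cancel₀ hn
  have hsq : Integrable (fun y => a y ^ 2) ν := h2.integrable_sq
  have hnorm : ∫ y, ‖(a y : ℂ)‖ ^ 2 ∂ν = ∫ y, a y ^ 2 ∂ν := by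
    congr 1 with y
    rw [Complex.norm_real, Real.norm_eq_abs, sq_abs]
  have hgg : Tendsto (fun n => ∫ y, ‖g n y‖ ^ 2 ∂ν) atTop (𝓝 (∫ y, ‖(a y : ℂ)‖ ^ 2 ∂ν)) := by
    have hc : ∀ n, ∫ y, ‖g n y‖ ^ 2 ∂ν = ‖(κ n)⁻¹‖ ^ 2 * ∫ y, ‖(a y : ℂ)‖ ^ 2 ∂ν := by
      intro n
      rw [← integral_const_mul]
      congr 1 with y
      simp only [hg]
      rw [norm_mul, norm_smul, hen, mul_one, mul_pow, Complex.norm_real]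
    simp_rw [hc]
    have := (((hκ1.inv₀ one_ne_zero).norm).pow 2).mul_const (∫ y, ‖(a y : ℂ)‖ ^ 2 ∂ν)
    simpa using this
  have hgh : Tendsto (fun n => ∫ y, g n y * conj (a y : ℂ) ∂ν) atTop
      (𝓝 ((∫ y, ‖(a y : ℂ)‖ ^ 2 ∂ν : ℝ) : ℂ)) := by
    have hc : ∀ n, ∫ y, g n y * conj (a y : ℂ) ∂ν = (κ n)⁻¹ * ∫ y, (a y ^ 2) • e n y ∂ν := by
      intro n
      rw [← integral_const_mul]
      congr 1 with y
      simp only [hg, Complex.conj_ofReal, Complex.real_smul]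
      push_cast
      ring
    simp_rw [hc, hnorm]
    have := (hκ1.inv₀ one_ne_zero).mul (tendsto_integral_mul_exp (ha.pow_const 2) hsq hu t hs)
    rwa [inv_one, one_mul] at this
  have hdiff := hS.tendsto_avgProd_sub_avgProd (fun n => (haem n).const_mul _) hm2
    (fun n => (hae n).const_mul _) h2c hg1 h1c hgg hgh
  have hlim := hdiff.add (tendsto_sub_nhds_zero_iff.2 hκm).norm
  rw [norm_zero, add_zero] at hlim
  refine squeeze_zero' (.of_forall fun n => integral_nonneg fun _ => norm_nonneg _) ?_ hlim
  filter_upwards [hκ0, hcard] with n hn hT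
  have i1 := integrable_avgProd (ι := E n) (S n) ((haem n).const_mul (κ n)⁻¹)
    ((hae n).const_mul _)
  have i2 := integrable_avgProd (ι := E n) (S n) hm2 h2c
  have i3 := (integrable_partitionAvg (ι := E n) (S n) hai).const_mul ‖κ n ^ m n - φ‖
  have i12 : Integrable (fun x : E n → X => ‖avgProd (S n) (fun y => (κ n)⁻¹ * (a y • e n y)) x -
      avgProd (S n) (fun y => (a y : ℂ)) x‖) (Measure.pi fun _ => ν) := (i1.sub i2).norm
  calc _ ≤ ∫ x : E n → X, (‖avgProd (S n) (fun y => (κ n)⁻¹ * (a y • e n y)) x -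
        avgProd (S n) (fun y => (a y : ℂ)) x‖ + ‖κ n ^ m n - φ‖ * partitionAvg (S n) a x)
          ∂(Measure.pi fun _ => ν) := by
        refine integral_mono_of_nonneg (.of_forall fun _ => norm_nonneg _) (i12.add i3)
          (.of_forall fun x => ?_)
        have hx : avgProd (S n) (fun y => a y • e n y) x =
            κ n ^ m n * avgProd (S n) (fun y => (κ n)⁻¹ * (a y • e n y)) x := by
          rw [← avgProd_const_mul hT]
          congr 1 with y
          rw [mul_inv_cancel_left₀ hn]
        simp only
        rw [tiltedAvg_exp]
        change ‖avgProd (S n) (fun y => a y • e n y) x - _‖ ≤ _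
        rw [hx, ofReal_partitionAvg]
        set z := avgProd (S n) (fun y => (κ n)⁻¹ * (a y • e n y)) x
        have hpa : partitionAvg (S n) a x = ‖avgProd (S n) (fun y => (a y : ℂ)) x‖ := by
          rw [← ofReal_partitionAvg, Complex.norm_real,
            Real.norm_of_nonneg (partitionAvg_nonneg _ ha0 _)]
        rw [hpa]
        set z' := avgProd (S n) (fun y => (a y : ℂ)) x
        have : κ n ^ m n * z - φ * z' = κ n ^ m n * (z - z') + (κ n ^ m n - φ) * z' := by ring
        rw [this]
        refine (norm_add_le _ _).trans ?_
        rw [norm_mul, norm_mul, norm_pow]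
        gcongr
        exact mul_le_of_le_one_left (norm_nonneg _) (pow_le_one₀ (norm_nonneg _) (hκn n))
    _ = (∫ x : E n → X, ‖avgProd (S n) (fun y => (κ n)⁻¹ * (a y • e n y)) x -
        avgProd (S n) (fun y => (a y : ℂ)) x‖ ∂(Measure.pi fun _ => ν)) +
        ‖κ n ^ m n - φ‖ * ∫ x : E n → X, partitionAvg (S n) a x ∂(Measure.pi fun _ => ν) := by
        rw [integral_add i12 i3, integral_const_mul]
    _ ≤ _ := by
        gcongr
        exact mul_le_of_le_one_right (norm_nonneg _) (integral_partitionAvg_le (S n) hai h1)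

/-- The `L¹` bound for exponentials dominates the integral over any event, so `A n` may be chosen
afterwards, depending on `f`. Lévy's theorem for the annealed laws, of mass `∫_A Z`, then replaces
exponentials by `f`. -/
lemma IsAlmostIndependent.tendsto_setIntegral_tiltedAvg_sub (hS : IsAlmostIndependent S p)
    {m : ℕ → ℕ} (hcard : ∀ᶠ n in atTop, ∀ π ∈ S n, π.card = m n) (hm : Tendsto m atTop atTop)
    (ha : Measurable a) (ha0 : ∀ y, 0 ≤ a y) (h2 : MemLp a 2 ν) (h1 : ∫ y, a y ∂ν = 1)
    (hu : Measurable u) {μ : Measure ℝ} [IsProbabilityMeasure μ]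
    (hclt : ∀ t : ℝ, Tendsto (fun n : ℕ =>
      (∫ y, a y • Complex.exp ((t * u y / √n : ℝ) * Complex.I) ∂ν) ^ n) atTop (𝓝 (charFun μ t)))
    (f : ℝ →ᵇ ℝ) (A : ∀ n, Set (E n → X)) :
    Tendsto (fun n => ∫ x in A n, (tiltedAvg (S n) a u (√(m n)) f x -
      (∫ y, f y ∂μ) * partitionAvg (S n) a x) ∂(Measure.pi fun _ => ν)) atTop (𝓝 0) := by
  have hai : Integrable a ν := h2.integrable (by norm_num)
  have hfin := fun n => isFiniteMeasure_annealedLaw (u := u) (S n) (√(m n)) (A n) hai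
  have hmass := fun n => real_univ_annealedLaw (S n) (√(m n)) (A n) ha ha0 hu hai
  have key := tendsto_integral_sub_of_tendsto_charFun
    (M := fun n => annealedLaw ν (S n) a u (√(m n)) (A n)) (μ := μ) ?_ ?_ f
  · refine key.congr fun n => ?_
    rw [hmass, integral_annealedLaw (S n) _ (A n) ha ha0 hu hai f.continuous f.norm_coe_le_norm,
      integral_sub (integrable_tiltedAvg (S n) _ hu hai f.continuous f.norm_coe_le_norm).integrableOn
        ((integrable_partitionAvg (S n) hai).const_mul _).integrableOn,
      integral_const_mul, mul_comm]
  · intro n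
    rw [hmass]
    exact (setIntegral_le_integral (integrable_partitionAvg (S n) hai)
      (.of_forall fun x => partitionAvg_nonneg _ ha0 x)).trans
      (integral_partitionAvg_le (S n) hai h1)
  · intro t
    have hlim := hS.tendsto_tiltedAvg_exp_sub hcard hm ha ha0 h2 h1 hu (hclt t)
    refine squeeze_zero_norm (fun n => ?_) hlim
    have hgc : Continuous fun y : ℝ => Complex.exp (t * y * Complex.I) := by fun_prop
    have hgb : ∀ y : ℝ, ‖Complex.exp (t * y * Complex.I)‖ ≤ 1 := fun y => by
      rw [← Complex.ofReal_mul, Complex.norm_exp_ofReal_mul_I]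
    have i1 := integrable_tiltedAvg (ν := ν) (a := a) (S n) (√(m n)) hu hai hgc hgb
    have i2 : Integrable (fun x : E n → X => charFun μ t * (partitionAvg (S n) a x : ℂ))
      (Measure.pi fun _ => ν) := (integrable_partitionAvg (S n) hai).ofReal.const_mul _
    rw [charFun_apply_real, hmass, integral_annealedLaw (S n) _ (A n) ha ha0 hu hai hgc hgb,
      ← integral_complex_ofReal, mul_comm, ← integral_const_mul,
      ← integral_sub i1.integrableOn i2.integrableOn]
    refine (norm_integral_le_integral_norm _).trans ?_
    exact setIntegral_le_integral (i1.sub i2).norm (.of_forall fun x => norm_nonneg _)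

/-- Weak convergence in probability of the Gibbs measures. -/
theorem IsAlmostIndependent.tendsto_measure_tiltedAvg_div (hS : IsAlmostIndependent S p)
    {m : ℕ → ℕ} (hcard : ∀ᶠ n in atTop, ∀ π ∈ S n, π.card = m n) (hm : Tendsto m atTop atTop)
    (ha : Measurable a) (ha0 : ∀ y, 0 ≤ a y) (h2 : MemLp a 2 ν) (h1 : ∫ y, a y ∂ν = 1)
    (hu : Measurable u) {μ : Measure ℝ} [IsProbabilityMeasure μ]
    (hclt : ∀ t : ℝ, Tendsto (fun n : ℕ =>
      (∫ y, a y • Complex.exp ((t * u y / √n : ℝ) * Complex.I) ∂ν) ^ n) atTop (𝓝 (charFun μ t)))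
    (f : ℝ →ᵇ ℝ) {ε : ℝ} (hε : 0 < ε) :
    Tendsto (fun n => (Measure.pi fun _ : E n => ν).real {x | ε ≤
      |tiltedAvg (S n) a u (√(m n)) f x / partitionAvg (S n) a x - ∫ y, f y ∂μ|}) atTop (𝓝 0) := by
  have hai : Integrable a ν := h2.integrable (by norm_num)
  have hone : ∀ (f : ℝ →ᵇ ℝ) (η : ℝ), 0 < η →
      Tendsto (fun n => (Measure.pi fun _ : E n => ν).real {x | η ≤ partitionAvg (S n) a x ∧
        ε ≤ tiltedAvg (S n) a u (√(m n)) f x / partitionAvg (S n) a x - ∫ y, f y ∂μ})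
        atTop (𝓝 0) := by
    intro f η hη
    -- On this event the integrand `T_f - Z ∫ f` is at least `η ε`, so its integral controls the
    -- probability.
    set A : ∀ n, Set (E n → X) := fun n => {x | η ≤ partitionAvg (S n) a x ∧
        ε ≤ tiltedAvg (S n) a u (√(m n)) f x / partitionAvg (S n) a x - ∫ y, f y ∂μ} with hA
    have hAm : ∀ n, MeasurableSet (A n) := fun n => by
      have hZ := measurable_partitionAvg (X := X) (S n) ha
      have hT := measurable_tiltedAvg (S n) ha hu (√(m n)) f.continuous
      exact (measurableSet_le measurable_const hZ).inter
        (measurableSet_le measurable_const ((hT.div hZ).sub_const _))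
    have hlim := (hS.tendsto_setIntegral_tiltedAvg_sub hcard hm ha ha0 h2 h1 hu hclt f A).const_mul
      (η * ε)⁻¹
    rw [mul_zero] at hlim
    refine squeeze_zero (fun n => measureReal_nonneg) (fun n => ?_) hlim
    rw [le_inv_mul_iff₀ (by positivity)]
    have hint : Integrable (fun x => tiltedAvg (S n) a u (√(m n)) f x -
        (∫ y, f y ∂μ) * partitionAvg (S n) a x) (Measure.pi fun _ : E n => ν) :=
      (integrable_tiltedAvg (S n) _ hu hai f.continuous f.norm_coe_le_norm).sub
        ((integrable_partitionAvg (S n) hai).const_mul _)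
    have := setIntegral_mono_on (integrableOn_const (μ := Measure.pi fun _ : E n => ν) (C := η * ε)
      (measure_ne_top _ (A n))) hint.integrableOn (hAm n) ?_
    · rw [setIntegral_const, smul_eq_mul] at this
      linarith
    · rintro x ⟨hx1, hx2⟩
      have hZ : 0 < partitionAvg (S n) a x := hη.trans_le hx1
      have h3 : tiltedAvg (S n) a u (√(m n)) f x - (∫ y, f y ∂μ) * partitionAvg (S n) a x =
          partitionAvg (S n) a x *
            (tiltedAvg (S n) a u (√(m n)) f x / partitionAvg (S n) a x - ∫ y, f y ∂μ) := by
        field_simp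
      rw [h3]
      gcongr
  obtain ⟨C, hC, htight⟩ := hS.exists_measure_partitionAvg_lt ha ha0 h2 h1
  rw [Metric.tendsto_atTop']
  intro δ hδ
  -- With this threshold a small `Z` costs at most `δ/2`; the upper and lower deviations, obtained
  -- from `f` and `-f`, share the other half.
  have hη : 0 < δ / (2 * C) := by positivity
  have hsum := (hone f _ hη).add (hone (-f) _ hη)
  rw [add_zero] at hsum
  obtain ⟨N, hN⟩ := eventually_atTop.1 ((htight _ hη).and
    (hsum.eventually_lt_const (show 0 < δ / 2 by positivity)))
  refine ⟨N, fun n hn => ?_⟩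
  obtain ⟨hn1, hn2⟩ := hN n hn.le
  rw [Real.dist_eq, sub_zero, abs_of_nonneg measureReal_nonneg]
  have hsub : {x : E n → X | ε ≤
      |tiltedAvg (S n) a u (√(m n)) f x / partitionAvg (S n) a x - ∫ y, f y ∂μ|} ⊆
      {x | partitionAvg (S n) a x < δ / (2 * C)} ∪
      ({x | δ / (2 * C) ≤ partitionAvg (S n) a x ∧
        ε ≤ tiltedAvg (S n) a u (√(m n)) f x / partitionAvg (S n) a x - ∫ y, f y ∂μ} ∪
      {x | δ / (2 * C) ≤ partitionAvg (S n) a x ∧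
        ε ≤ tiltedAvg (S n) a u (√(m n)) (-f) x / partitionAvg (S n) a x -
          ∫ y, (-f) y ∂μ}) := by
    intro x hx
    simp only [Set.mem_union, Set.mem_ofPred_eq] at hx ⊢
    rcases lt_or_ge (partitionAvg (S n) a x) (δ / (2 * C)) with h | h
    · exact Or.inl h
    · right
      rcases le_abs.1 hx with h' | h'
      · exact Or.inl ⟨h, h'⟩
      · refine Or.inr ⟨h, h'.trans (le_of_eq ?_)⟩
        have : tiltedAvg (S n) a u (√(m n)) (-f) x = -tiltedAvg (S n) a u (√(m n)) f x := by
          simp [tiltedAvg]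
        rw [this]
        simp only [BoundedContinuousFunction.coe_neg, Pi.neg_apply, integral_neg]
        ring
  calc _ ≤ _ := measureReal_mono hsub
    _ ≤ _ := measureReal_union_le _ _
    _ ≤ _ := add_le_add_right (measureReal_union_le _ _) _
    _ < C * (δ / (2 * C)) + δ / 2 := add_lt_add_of_le_of_lt hn1 hn2
    _ = δ := by field_simp; ring

end GibbsLimit

/-! ### Gibbs averages as ratios -/

section Ratio

variable {β : ℝ}

lemma boltzmann_ne_top (hβ : 0 < β) {x : EReal} (hx : x ≠ ⊥) : boltzmann β x ≠ ∞ := by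
  induction x with
  | bot => simp at hx
  | top => simp [boltzmann_top hβ]
  | coe x => simp [boltzmann_coe]

/-- The value `⊥` must be excluded: `⊤ + ⊥ = ⊥` has factor `∞`, whereas `0 * ∞ = 0`. -/
lemma boltzmann_add (hβ : 0 < β) {x y : EReal} (hx : x ≠ ⊥) (hy : y ≠ ⊥) :
    boltzmann β (x + y) = boltzmann β x * boltzmann β y := by
  induction x with
  | bot => simp at hx
  | top => rw [EReal.top_add_of_ne_bot hy, boltzmann_top hβ, zero_mul]
  | coe x =>
    induction y with
    | bot => simp at hy
    | top => rw [EReal.add_top_of_ne_bot hx, boltzmann_top hβ, mul_zero]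
    | coe y =>
      rw [← EReal.coe_add, boltzmann_coe, boltzmann_coe, boltzmann_coe,
        ← ENNReal.ofReal_mul (by positivity), ← Real.exp_add]
      congr 2
      ring

variable {ι : Type*} {x : ι → EReal}

lemma weight_ne_bot (hx : ∀ e, x e ≠ ⊥) (π : Finset ι) : weight x π ≠ ⊥ := by
  unfold weight
  induction π using Finset.cons_induction with
  | empty => simp
  | cons e π he ih =>
    rw [Finset.sum_cons, ne_eq, EReal.add_eq_bot_iff]
    simp [hx e, ih]

lemma boltzmann_weight (hβ : 0 < β) (hx : ∀ e, x e ≠ ⊥) (π : Finset ι) :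
    boltzmann β (weight x π) = ∏ e ∈ π, boltzmann β (x e) := by
  induction π using Finset.cons_induction with
  | empty => simp [weight, boltzmann]
  | cons e π he ih =>
    rw [Finset.prod_cons, ← ih, ← boltzmann_add hβ (hx e) (weight_ne_bot hx π), weight,
      Finset.sum_cons, weight]

lemma weight_eq_coe_sum {π : Finset ι} (hx : ∀ e, x e ≠ ⊥) (hx' : ∀ e ∈ π, x e ≠ ⊤) :
    weight x π = ((∑ e ∈ π, (x e).toReal : ℝ) : EReal) := by
  induction π using Finset.cons_induction with
  | empty => simp [weight]
  | cons e π he ih =>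
    have h := ih fun g hg => hx' g (Finset.mem_cons_of_mem hg)
    rw [weight] at h
    rw [weight, Finset.sum_cons, h, Finset.sum_cons, EReal.coe_add,
      EReal.coe_toReal (hx' e (Finset.mem_cons_self e π)) (hx e)]

lemma toReal_boltzmann_weight {ν : Measure EReal} (hν : WeightAssumption ν) (hβ : 0 < β)
    (hx : ∀ e, x e ≠ ⊥) (π : Finset ι) :
    (boltzmann β (weight x π)).toReal =
      (laplace ν β).toReal ^ π.card * ∏ e ∈ π, normWeight ν β (x e) := by
  have hL : (laplace ν β).toReal ≠ 0 :=
    (ENNReal.toReal_pos (hν β hβ).1.ne' (hν β hβ).2.ne).ne'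
  rw [boltzmann_weight hβ hx, ENNReal.toReal_prod]
  simp only [normWeight]
  rw [Finset.prod_div_distrib, Finset.prod_const]
  field_simp

/-- Equal sizes make the normalisation `laplace ^ k` cancel. If the partition function vanishes,
both sides are `0` by the conventions for division. -/
lemma gibbsProb_eq {ν : Measure EReal} (hν : WeightAssumption ν) (hβ : 0 < β)
    (hx : ∀ e, x e ≠ ⊥) {S : Finset (Finset ι)} {k : ℕ} (hS : ∀ π ∈ S, π.card = k)
    {π : Finset ι} (hπ : π ∈ S) :
    gibbsProb S β x π = (∏ e ∈ π, normWeight ν β (x e)) /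
      ∑ π' ∈ S, ∏ e ∈ π', normWeight ν β (x e) := by
  have hL : (laplace ν β).toReal ≠ 0 :=
    (ENNReal.toReal_pos (hν β hβ).1.ne' (hν β hβ).2.ne).ne'
  have hcard : (S.card : ℝ≥0∞) ≠ 0 := by
    rw [Nat.cast_ne_zero, Finset.card_ne_zero]
    exact ⟨π, hπ⟩
  rw [gibbsProb, partitionFn, ENNReal.div_mul_cancel hcard (ENNReal.natCast_ne_top _),
    ENNReal.toReal_div, ENNReal.toReal_sum fun π' _ => boltzmann_ne_top hβ (weight_ne_bot hx π'),
    toReal_boltzmann_weight hν hβ hx, hS π hπ]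
  have : ∀ π' ∈ S, (boltzmann β (weight x π')).toReal =
      (laplace ν β).toReal ^ k * ∏ e ∈ π', normWeight ν β (x e) := fun π' hπ' => by
    rw [toReal_boltzmann_weight hν hβ hx, hS π' hπ']
  rw [Finset.sum_congr rfl this, ← Finset.mul_sum, mul_div_mul_left _ _ (pow_ne_zero _ hL)]

lemma gibbsAverage_eq_div {ν : Measure EReal} (hν : WeightAssumption ν) (hβ : 0 < β)
    (hx : ∀ e, x e ≠ ⊥) {S : Finset (Finset ι)} {k : ℕ} (hS : ∀ π ∈ S, π.card = k)
    (f : ℝ → ℝ) (d s : ℝ) :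
    gibbsAverage S β x (fun π => f (((weight x π).toReal + (k : ℝ) * d) / s)) =
      tiltedAvg S (normWeight ν β) (fun y => y.toReal + d) s f x /
        partitionAvg S (normWeight ν β) x := by
  have hZ : partitionAvg S (normWeight ν β) x =
      (∑ π ∈ S, ∏ e ∈ π, normWeight ν β (x e)) / (S.card : ℝ) := by
    rw [partitionAvg, Finset.sum_div]
  rw [hZ, gibbsAverage, tiltedAvg, Finset.sum_div]
  refine Finset.sum_congr rfl fun π hπ => ?_
  have hcard : (S.card : ℝ) ≠ 0 := by
    rw [Nat.cast_ne_zero, Finset.card_ne_zero]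
    exact ⟨π, hπ⟩
  rw [gibbsProb_eq hν hβ hx hS hπ]
  have hf : (∏ e ∈ π, normWeight ν β (x e)) * f (((weight x π).toReal + (k : ℝ) * d) / s) =
      (∏ e ∈ π, normWeight ν β (x e)) * f ((∑ e ∈ π, ((x e).toReal + d)) / s) := by
    -- A configuration with an infinite edge falls in the vanishing case, where the argument of `f`
    -- is irrelevant.
    by_cases h0 : ∏ e ∈ π, normWeight ν β (x e) = 0
    · rw [h0, zero_mul, zero_mul]
    · have htop : ∀ e ∈ π, x e ≠ ⊤ := by
        intro e he h
        refine h0 (Finset.prod_eq_zero he ?_)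
        rw [h, normWeight, boltzmann_top hβ]
        simp
      rw [weight_eq_coe_sum hx htop, EReal.toReal_coe, Finset.sum_add_distrib, Finset.sum_const,
        hS π hπ, nsmul_eq_mul]
  rw [smul_eq_mul, div_mul_eq_mul_div, hf, div_mul_eq_mul_div, div_div_div_cancel_right₀ hcard]

end Ratio

lemma isAlmostIndependent_of_familyAssumption {V : ℕ → Type*} [∀ n, Finite (V n)]
    {G : ∀ n, SimpleGraph (V n)} [∀ n, Fintype (G n).edgeSet]
    {S : ∀ n, Finset (Finset (G n).edgeSet)} {m : ℕ → ℕ}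
    (hG : GraphAssumption G) (hS : FamilyAssumption G S m) :
    IsAlmostIndependent S (edgeProb G m) where
  nonneg := edgeProb_nonneg
  tendsto_zero := tendsto_edgeProb hG hS
  exists_bound := by
    simpa only [Nat.card_eq_fintype_card] using exists_edgeProb_sq_mul_le hG hS
  tendsto_sum _ hA := tendsto_sum_sq_inclProb_sub hG hS hA

end

end RandomOpt

/-- The joint law of independent weights. -/
lemma RandomOpt.hasLaw_pi {ι Ω : Type*} [Fintype ι] [MeasurableSpace Ω] {P : Measure Ω}
    [IsProbabilityMeasure P] {ν : Measure EReal} {w : ι → Ω → EReal}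
    (hlaw : ∀ e, HasLaw (w e) ν P) (hindep : iIndepFun w P) :
    HasLaw (fun ω e => w e ω) (Measure.pi fun _ => ν) P where
  aemeasurable := aemeasurable_pi_lambda _ fun e => (hlaw e).aemeasurable
  map_eq := by
    rw [(iIndepFun_iff_map_fun_eq_pi_map fun e => (hlaw e).aemeasurable).1 hindep]
    simp_rw [fun e => (hlaw e).map_eq]

/-- Quenched CLT for a typical configuration. The random law (given the weights) of
`(W(π) + m ψ'(β)) / √m` under the Gibbs measure converges weakly, in probability with respect to
the weights, to the centred Gaussian law with variance `ψ''(β)`. A configuration of weight `+∞`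
has Gibbs probability `0`, so `toReal` is only applied to finite weights (up to null sets). -/
theorem theorem2p7
    {V : ℕ → Type*} [∀ n, Finite (V n)] (G : ∀ n, SimpleGraph (V n))
    (S : ∀ n, Finset (Finset (G n).edgeSet)) (m : ℕ → ℕ)
    (ν : Measure EReal) [IsProbabilityMeasure ν]
    {Ω : ℕ → Type*} [∀ n, MeasurableSpace (Ω n)]
    (P : ∀ n, Measure (Ω n)) [∀ n, IsProbabilityMeasure (P n)]
    (w : ∀ n, (G n).edgeSet → Ω n → EReal)
    (hG : RandomOpt.GraphAssumption G)
    (hν : RandomOpt.WeightAssumption ν)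
    (hlaw : ∀ n e, HasLaw (w n e) ν (P n))
    (hindep : ∀ n, iIndepFun (w n) (P n))
    (hS : RandomOpt.FamilyAssumption G S m)
    (β : ℝ) (hβ : 0 < β) :
    ContDiffAt ℝ 2 (RandomOpt.psi ν) β ∧
    0 ≤ deriv (deriv (RandomOpt.psi ν)) β ∧
    ∀ f : ℝ →ᵇ ℝ, ∀ ε : ℝ, 0 < ε →
      Tendsto (fun n => P n {ω | ε ≤
          |RandomOpt.gibbsAverage (S n) β (fun e => w n e ω)
              (fun π => f (((RandomOpt.weight (fun e => w n e ω) π).toReal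
                + (m n : ℝ) * deriv (RandomOpt.psi ν) β) / √(m n : ℝ)))
            - ∫ x, f x ∂(gaussianReal 0 (deriv (deriv (RandomOpt.psi ν)) β).toNNReal)|})
        atTop (𝓝 0) := by
  refine ⟨RandomOpt.contDiffAt_psi hν hβ, ?_, fun f ε hε => ?_⟩
  · rw [← RandomOpt.variance_tiltedLaw hν hβ]
    exact variance_nonneg _ _
  have : ∀ n, Fintype (G n).edgeSet := fun n => Fintype.ofFinite _
  have ha := RandomOpt.measurable_normWeight ν β
  have hu : Measurable fun y : EReal => y.toReal + deriv (RandomOpt.psi ν) β := by fun_prop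
  have key := (RandomOpt.isAlmostIndependent_of_familyAssumption hG
    hS).tendsto_measure_tiltedAvg_div (ν := ν) hS.card_eq (RandomOpt.tendsto_size hG hS) ha
    (RandomOpt.normWeight_nonneg ν β) (RandomOpt.memLp_normWeight hν hβ)
    (RandomOpt.integral_normWeight hν hβ) hu
    (RandomOpt.tendsto_integral_normWeight_pow hν hβ) f hε
  have key2 := ENNReal.tendsto_ofReal key
  rw [ENNReal.ofReal_zero] at key2
  refine key2.congr' ?_
  filter_upwards [hS.card_eq] with n hn
  rw [ofReal_measureReal]
  have hT := RandomOpt.measurable_tiltedAvg (S n) ha hu (√(m n : ℝ)) f.continuous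
  have hZ := RandomOpt.measurable_partitionAvg (S n) ha
  -- The limit was proved on the product space; the joint law of the weights carries it to `Ω n`,
  -- almost surely with no weight equal to `⊥`.
  have htransfer := (RandomOpt.hasLaw_pi (hlaw n) (hindep n)).measure_eq
    (measurableSet_le (measurable_const (a := ε)) ((hT.div hZ).sub_const
      (∫ y, f y ∂(gaussianReal 0 (deriv (deriv (RandomOpt.psi ν)) β).toNNReal))).abs)
  refine htransfer.symm.trans ?_
  refine measure_congr ?_
  have hbot : ∀ᵐ ω ∂(P n), ∀ e, w n e ω ≠ ⊥ := by
    rw [ae_all_iff]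
    intro e
    refine ae_of_ae_map (hlaw n e).aemeasurable (p := fun y => y ≠ ⊥) ?_
    rw [(hlaw n e).map_eq]
    exact RandomOpt.ae_ne_bot hν
  filter_upwards [hbot] with ω hω
  refine propext ?_
  change ε ≤ _ ↔ ε ≤ _
  rw [RandomOpt.gibbsAverage_eq_div hν hβ hω hn]
  rfl
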